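/- Let $p,q\ge 0$ be integers. Let $Q(x)=x_0^2+\dots+x_p^2-x_{p+1}^2-\dots-x_{p+q}^2$ on $\mathbb{R}^{p+1+q}$, let $G=O(p+1,q)=\{g\in GL(p+1+q,\mathbb{R}) : Q(gx)=Q(x)\ \text{for all } x\}$, and let $H=O(p,q)$ be the stabilizer $\{g\in G : ge_0=e_0\}$ of the first standard basis vector $e_0$. Let $\theta g={}^t g^{-1}$ be the standard Cartan involution, $\mathfrak g$ and $\mathfrak h$ the Lie algebras of $G$ and $H$, $K=\{g\in G:\theta g=g\}\ (\cong O(p+1)\times O(q))$, and $\mathfrak p=\{X\in\mathfrak g: {}^tX=X\}$. The Cartan motion group of $G$ is the semidirect product $G_\theta=K\ltimes_{\mathrm{Ad}}\mathfrak p$, with multiplication $(k_1,X_1)(k_2,X_2)=(k_1k_2,\,X_1+k_1X_2k_1^{-1})$ and the product topology, and $H_\theta=(K\cap H)\ltimes_{\mathrm{Ad}}(\mathfrak p\cap\mathfrak h)\subset G_\theta$. The homogeneous space $G_\theta/H_\theta$ is the tangential symmetric space of $O(p+1,q)/O(p,q)$. It is said to admit a compact Clifford–Klein form if there is a discrete subgroup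 $\Gamma\subset G_\theta$ which acts properly discontinuously and freely on $G_\theta/H_\theta$ by left translations and for which the double coset space $\Gamma\backslash G_\theta/H_\theta$ is compact in the quotient topology. **Lemma.** The following two conditions are equivalent: (i) the tangential symmetric space $G_\theta/H_\theta$ of $O(p+1,q)/O(p,q)$ admits a compact Clifford–Klein form; (ii) there exists a bilinear map $f:\mathbb{R}^{p+1}\times\mathbb{R}^q\to\mathbb{R}^q$ such that $f(v,w)=0$ only if $v=0$ or $w=0$. -/

import Mathlib

noncomputable section

namespace TangentialSpaceForm

open Matrix

/-! ## Compact Clifford–Klein forms -/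

section CliffordKlein

variable {G : Type*} [Group G] [TopologicalSpace G]

/-- `Γ` is a discontinuous group for the homogeneous space `G ⧸ H`: it is a discrete subgroup of `G`
which acts on `G ⧸ H` by left translations properly discontinuously and freely. -/
structure IsDiscontinuousGroup (Γ H : Subgroup G) : Prop where
  discrete : DiscreteTopology Γ
  properlyDiscontinuous : ProperlyDiscontinuousSMul Γ (G ⧸ H)
  free : ∀ (γ : Γ) (x : G ⧸ H), γ • x = x → γ = 1

/-- `G ⧸ H` admits a compact Clifford–Klein form: for some discontinuous group `Γ` for `G ⧸ H`, the
double coset space `Γ \ G ⧸ H`, with its quotient topology, is compact. -/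
def AdmitsCompactCliffordKleinForm (H : Subgroup G) : Prop :=
  ∃ Γ : Subgroup G, IsDiscontinuousGroup Γ H ∧
    CompactSpace (Quotient (MulAction.orbitRel Γ (G ⧸ H)))

end CliffordKlein

/-! ## Tangential homogeneous spaces of linear groups

`G` is a subgroup of `GL n ℝ`; the definitions are meant for a closed `G` that is stable under the
Cartan involution `θ g = (gᵀ)⁻¹`. -/

section CartanMotion

variable {n : Type*} [Fintype n] [DecidableEq n]

/-- The Lie algebra of a linear Lie group `G`, namely the set of the matrices `X` with
`exp (t X) ∈ G` for all real `t`. For a closed `G` this set is itself a linear subspace; the span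
only bundles it as a `Submodule`. -/
def lieAlgebra (G : Subgroup (GL n ℝ)) : Submodule ℝ (Matrix n n ℝ) :=
  Submodule.span ℝ {X | ∀ t : ℝ, ∃ g ∈ G, (g : Matrix n n ℝ) = NormedSpace.exp (t • X)}

/-- `K`: the subgroup of `G` fixed by the Cartan involution `θ g = (gᵀ)⁻¹`. -/
def fixedSubgroup (G : Subgroup (GL n ℝ)) : Subgroup (GL n ℝ) where
  carrier := {k | k ∈ G ∧ (k : Matrix n n ℝ)ᵀ = ((k⁻¹ : GL n ℝ) : Matrix n n ℝ)}
  mul_mem' := by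
    rintro a b ⟨ha, ha'⟩ ⟨hb, hb'⟩
    refine ⟨G.mul_mem ha hb, ?_⟩
    rw [_root_.mul_inv_rev, Units.val_mul, Units.val_mul, Matrix.transpose_mul, ha', hb']
  one_mem' := ⟨G.one_mem, by simp⟩
  inv_mem' := by
    rintro a ⟨ha, ha'⟩
    refine ⟨G.inv_mem ha, ?_⟩
    rw [← ha', Matrix.transpose_transpose, inv_inv]

/-- `𝔭`: the `-1`-eigenspace of the differential `X ↦ -Xᵀ` of `θ` on the Lie algebra of `G`, so that
`𝔤 = 𝔨 + 𝔭` is the Cartan decomposition. -/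
def symmetricPart (G : Subgroup (GL n ℝ)) : Submodule ℝ (Matrix n n ℝ) where
  carrier := {X | X ∈ lieAlgebra G ∧ Xᵀ = X}
  add_mem' := by
    rintro X Y ⟨hX, hX'⟩ ⟨hY, hY'⟩
    exact ⟨add_mem hX hY, by rw [Matrix.transpose_add, hX', hY']⟩
  zero_mem' := ⟨zero_mem _, Matrix.transpose_zero⟩
  smul_mem' := by
    rintro c X ⟨hX, hX'⟩
    exact ⟨Submodule.smul_mem _ c hX, by rw [Matrix.transpose_smul, hX']⟩

theorem conj_mem_lieAlgebra {G : Subgroup (GL n ℝ)} {g : GL n ℝ} (hg : g ∈ G)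
    {X : Matrix n n ℝ} (hX : X ∈ lieAlgebra G) :
    (g : Matrix n n ℝ) * X * ((g⁻¹ : GL n ℝ) : Matrix n n ℝ) ∈ lieAlgebra G := by
  induction hX using Submodule.span_induction with
  | mem X hX =>
    refine Submodule.subset_span fun t => ?_
    obtain ⟨h, hh, e⟩ := hX t
    refine ⟨g * h * g⁻¹, G.mul_mem (G.mul_mem hg hh) (G.inv_mem hg), ?_⟩
    rw [Units.val_mul, Units.val_mul, e, ← Matrix.exp_units_conj]
    simp
  | zero => simp
  | add X Y _ _ hX hY => rw [mul_add, add_mul]; exact add_mem hX hY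
  | smul c X _ hX => rw [mul_smul_comm, smul_mul_assoc]; exact Submodule.smul_mem _ c hX

theorem conj_mem_symmetricPart {G : Subgroup (GL n ℝ)} {k : GL n ℝ} (hk : k ∈ fixedSubgroup G)
    {X : Matrix n n ℝ} (hX : X ∈ symmetricPart G) :
    (k : Matrix n n ℝ) * X * ((k⁻¹ : GL n ℝ) : Matrix n n ℝ) ∈ symmetricPart G := by
  refine ⟨conj_mem_lieAlgebra hk.1 hX.1, ?_⟩
  rw [← hk.2, Matrix.transpose_mul, Matrix.transpose_mul, Matrix.transpose_transpose, hX.2,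
    mul_assoc]

/-- The adjoint action `Ad k : X ↦ k X k⁻¹` of `k ∈ K` on `𝔭`. -/
def Ad (G : Subgroup (GL n ℝ)) (k : fixedSubgroup G) : symmetricPart G →ₗ[ℝ] symmetricPart G where
  toFun X := ⟨(k : GL n ℝ) * X * ((k : GL n ℝ)⁻¹ : GL n ℝ), conj_mem_symmetricPart k.2 X.2⟩
  map_add' X Y := by ext1; simp [mul_add, add_mul]
  map_smul' c X := by ext1; simp

theorem Ad_one {G : Subgroup (GL n ℝ)} (X : symmetricPart G) : Ad G 1 X = X := by
  ext1; simp [Ad]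

theorem Ad_mul {G : Subgroup (GL n ℝ)} (k l : fixedSubgroup G) (X : symmetricPart G) :
    Ad G (k * l) X = Ad G k (Ad G l X) := by
  ext1; simp only [Ad, LinearMap.coe_mk, AddHom.coe_mk, Subgroup.coe_mul, _root_.mul_inv_rev,
    Units.val_mul, mul_assoc]

/-- The adjoint action of `K` on the vector group `𝔭`, written multiplicatively. -/
def adjointAction (G : Subgroup (GL n ℝ)) :
    fixedSubgroup G →* MulAut (Multiplicative (symmetricPart G)) where
  toFun k :=
    { toFun := fun X => Multiplicative.ofAdd (Ad G k X.toAdd)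
      invFun := fun X => Multiplicative.ofAdd (Ad G k⁻¹ X.toAdd)
      left_inv := fun X => by
        dsimp only
        rw [toAdd_ofAdd, ← Ad_mul, inv_mul_cancel, Ad_one, ofAdd_toAdd]
      right_inv := fun X => by
        dsimp only
        rw [toAdd_ofAdd, ← Ad_mul, mul_inv_cancel, Ad_one, ofAdd_toAdd]
      map_mul' := fun X Y => by rw [toAdd_mul, map_add, ofAdd_add] }
  map_one' := by
    ext1 X
    exact congrArg Multiplicative.ofAdd (Ad_one X.toAdd)
  map_mul' k l := by
    ext1 X
    exact congrArg Multiplicative.ofAdd (Ad_mul k l X.toAdd)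

/-- The Cartan motion group `G_θ = K ⋉_Ad 𝔭` of `G`. An element `x` has the components
`x.left ∈ 𝔭` and `x.right ∈ K`, and the product is
`(X₁, k₁) (X₂, k₂) = (X₁ + Ad k₁ X₂, k₁ k₂)`. -/
def CartanMotionGroup (G : Subgroup (GL n ℝ)) : Type _ :=
  Multiplicative (symmetricPart G) ⋊[adjointAction G] fixedSubgroup G

instance (G : Subgroup (GL n ℝ)) : Group (CartanMotionGroup G) :=
  inferInstanceAs (Group (Multiplicative (symmetricPart G) ⋊[adjointAction G] fixedSubgroup G))

/-- The topology of the Cartan motion group is the product topology of `𝔭 × K`. -/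
instance (G : Subgroup (GL n ℝ)) : TopologicalSpace (CartanMotionGroup G) :=
  TopologicalSpace.induced
    (fun x => ((x.left.toAdd, x.right) : symmetricPart G × fixedSubgroup G)) inferInstance

/-- For a subgroup `H` of `G`, the Cartan motion group `H_θ = (K ∩ H) ⋉_Ad (𝔭 ∩ 𝔥)` of `H`, regarded
as a subgroup of `G_θ`. The tangential homogeneous space of `G ⧸ H` is
`CartanMotionGroup G ⧸ tangentialSubgroup G H`. -/
def tangentialSubgroup (G H : Subgroup (GL n ℝ)) : Subgroup (CartanMotionGroup G) where
  carrier := {x | (x.right : GL n ℝ) ∈ H ∧ (x.left.toAdd : Matrix n n ℝ) ∈ lieAlgebra H}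
  mul_mem' := by
    rintro a b ⟨ha, ha'⟩ ⟨hb, hb'⟩
    exact ⟨H.mul_mem ha hb, add_mem ha' (conj_mem_lieAlgebra ha hb')⟩
  one_mem' := ⟨H.one_mem, zero_mem _⟩
  inv_mem' := by
    rintro a ⟨ha, ha'⟩
    exact ⟨H.inv_mem ha, conj_mem_lieAlgebra (H.inv_mem ha) (neg_mem ha')⟩

end CartanMotion

/-! ## The indefinite orthogonal groups -/

/-- The quadratic form `x₁² + ⋯ + x_p² - x_{p+1}² - ⋯ - x_{p+q}²` on `ℝ^{p+q}`. -/
def indefiniteForm (p q : ℕ) (x : Fin p ⊕ Fin q → ℝ) : ℝ :=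
  ∑ i, x (Sum.inl i) ^ 2 - ∑ j, x (Sum.inr j) ^ 2

/-- The indefinite orthogonal group `O(p,q)`. -/
def indefiniteOrthogonal (p q : ℕ) : Subgroup (GL (Fin p ⊕ Fin q) ℝ) where
  carrier := {g | ∀ x, indefiniteForm p q ((g : Matrix (Fin p ⊕ Fin q) (Fin p ⊕ Fin q) ℝ) *ᵥ x) = indefiniteForm p q x}
  mul_mem' := by
    intro a b ha hb x
    rw [Units.val_mul, ← Matrix.mulVec_mulVec, ha, hb]
  one_mem' x := by rw [Units.val_one, Matrix.one_mulVec]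
  inv_mem' := by
    intro a ha x
    rw [← ha, Matrix.mulVec_mulVec, ← Units.val_mul, mul_inv_cancel, Units.val_one,
      Matrix.one_mulVec]

/-- `O(p,q)` as the subgroup of `O(p+1,q)` fixing the first standard basis vector `e₀`. -/
def indefiniteOrthogonalStabilizer (p q : ℕ) : Subgroup (GL (Fin (p + 1) ⊕ Fin q) ℝ) where
  carrier := {g | g ∈ indefiniteOrthogonal (p + 1) q ∧
    (g : Matrix (Fin (p + 1) ⊕ Fin q) (Fin (p + 1) ⊕ Fin q) ℝ) *ᵥ Pi.single (Sum.inl 0) 1 =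
      Pi.single (Sum.inl 0) 1}
  mul_mem' := by
    rintro a b ⟨ha, ha'⟩ ⟨hb, hb'⟩
    exact ⟨mul_mem ha hb, by rw [Units.val_mul, ← Matrix.mulVec_mulVec, hb', ha']⟩
  one_mem' := ⟨one_mem _, by rw [Units.val_one, Matrix.one_mulVec]⟩
  inv_mem' := by
    rintro a ⟨ha, ha'⟩
    refine ⟨inv_mem ha, ?_⟩
    conv_lhs => rw [← ha']
    rw [Matrix.mulVec_mulVec, ← Units.val_mul, inv_mul_cancel, Units.val_one, Matrix.one_mulVec]

end TangentialSpaceForm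

end

/-! The map `(X, k) H_θ ↦ (k e₀, X k e₀)` turns the homogeneous space into the trivial bundle over
the unit sphere of `ℝ^{p+1}` with fibre `ℝ^q`. An element of `𝔭` is a block off-diagonal symmetric
matrix, and as a translation it acts on the fibre over `v` by adding `X v`.

From a bilinear map `f` one gets `X_w ∈ 𝔭` with `X_w v = f(v, w)`. Nonsingularity and equality of
dimensions make `f(v, ·)` an isomorphism for every unit `v`, with bounds uniform in `v` by
compactness. So `ℤ^q` acts on every fibre as a lattice of translations, properly and cocompactly
(`admitsCompactCliffordKleinForm_of_expanding`).

Conversely, let `T ⊂ 𝔭` be the set of translation parts of `Γ`; the rotation parts lie in a compact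
group and only cost constants. Cocompactness makes `{X v : X ∈ T}` coarsely dense in `ℝ^q`, and
proper discontinuity bounds `X - X'` in terms of `(X - X') v`, both uniformly in `v`. Thus
evaluation at each `v` is a quasi-isometry from `T` to `ℝ^q`. `exists_linear_section` replaces `T`
by a linear space: rescale a coarse section, pass to an ultralimit, which is Lipschitz, and
differentiate it at a point given by Rademacher's theorem. The derivative `L : ℝ^q → 𝔭` yields `f(v,
w) = (L w) v`. -/

noncomputable section

namespace TangentialSpaceForm

/-! ### Linearisation of coarse sections -/

section CoarseToLinear

open Filter Topology

variable {E F : Type*} [NormedAddCommGroup E] [NormedSpace ℝ E]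
  [NormedAddCommGroup F] [NormedSpace ℝ F]

/-- Chaining: if the image of `T` under `s` is `R`-dense and points of `T` with images at distance
at most `2 R + 1` are at distance at most `D`, then `s` is a quasi-isometric embedding of `T`. -/
theorem norm_sub_le_of_dense {T : Set E} {s : E →L[ℝ] F} {R D : ℝ}
    (hR : 0 ≤ R) (hdense : ∀ w, ∃ t ∈ T, ‖s t - w‖ ≤ R)
    (hproper : ∀ t ∈ T, ∀ t' ∈ T, ‖s (t - t')‖ ≤ 2 * R + 1 → ‖t - t'‖ ≤ D)
    {t t' : E} (ht : t ∈ T) (ht' : t' ∈ T) :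
    ‖t - t'‖ ≤ D * ‖s (t - t')‖ + 2 * D := by
  have hD : 0 ≤ D := by
    have := hproper t ht t ht (by simp; positivity)
    simpa using this
  -- Walk from `w` to `s t'` in `n` steps of length at most 1, choosing a point of `T` near each
  -- stop. Consecutive choices have images within `2 * R + 1`, so each step costs at most `D`.
  have key : ∀ n : ℕ, ∀ w, ∀ u ∈ T, ‖s u - w‖ ≤ R → ‖w - s t'‖ ≤ n →
      ‖u - t'‖ ≤ (n + 1) * D := by
    intro n
    induction n with
    | zero =>
      intro w u hu h1 h2
      have : w = s t' := by
        rw [← sub_eq_zero, ← norm_le_zero_iff]; simpa using h2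
      subst this
      have := hproper u hu t' ht' (by rw [map_sub]; linarith)
      simpa using this
    | succ n ih =>
      intro w u hu h1 h2
      set c : ℝ := n / (n + 1) with hc
      have hn : (0 : ℝ) < n + 1 := by positivity
      obtain ⟨x, hx, hxw⟩ := hdense (s t' + c • (w - s t'))
      have e1 : ‖(s t' + c • (w - s t')) - s t'‖ ≤ n := by
        rw [add_sub_cancel_left, norm_smul, Real.norm_of_nonneg (by positivity)]
        push_cast at h2
        calc c * ‖w - s t'‖ ≤ c * (n + 1) := by gcongr
          _ = n := by rw [hc]; field_simp
      have e2 : ‖w - (s t' + c • (w - s t'))‖ ≤ 1 := by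
        have : w - (s t' + c • (w - s t')) = (1 / (n + 1) : ℝ) • (w - s t') := by
          have : (1 / (n + 1) : ℝ) = 1 - c := by rw [hc]; field_simp; ring
          rw [this]; module
        rw [this, norm_smul, Real.norm_of_nonneg (by positivity)]
        push_cast at h2
        calc 1 / ((n : ℝ) + 1) * ‖w - s t'‖ ≤ 1 / ((n : ℝ) + 1) * (n + 1) := by gcongr
          _ = 1 := by field_simp
      have e3 := ih _ x hx hxw e1
      have e4 : ‖u - x‖ ≤ D := by
        refine hproper u hu x hx ?_
        have : s (u - x) = (s u - w) + (w - (s t' + c • (w - s t')))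
            - (s x - (s t' + c • (w - s t'))) := by rw [map_sub]; abel
        rw [this]
        refine (norm_sub_le _ _).trans ?_
        have := norm_add_le (s u - w) (w - (s t' + c • (w - s t')))
        linarith
      calc ‖u - t'‖ = ‖(u - x) + (x - t')‖ := by congr 1; abel
        _ ≤ _ := norm_add_le _ _
        _ ≤ _ := by push_cast; linarith
  -- Rounding up costs less than one step and the base case one more, whence `2 * D`.
  have h := key ⌈‖s (t - t')‖⌉₊ (s t) t ht (by simpa using hR)
    (by rw [← map_sub]; exact Nat.le_ceil _)
  refine h.trans ?_
  have := Nat.ceil_lt_add_one (norm_nonneg (s (t - t')))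
  nlinarith

/-- Linearisation of a coarse section: if a subset `T` of `E` is mapped properly and onto a coarsely
dense subset by every member of a family of linear maps, uniformly in the family, then some linear
subspace of `E` is mapped isomorphically by every member. It is found as a tangent space of an
asymptotic cone of `T`. -/
theorem exists_linear_section [FiniteDimensional ℝ E] [FiniteDimensional ℝ F]
    {T : Set E} {S : Set (E →L[ℝ] F)} {R : ℝ}
    (hdense : ∀ s ∈ S, ∀ w, ∃ t ∈ T, ‖s t - w‖ ≤ R)
    (hproper : ∀ r : ℝ, ∃ D : ℝ, ∀ s ∈ S, ∀ t ∈ T, ∀ t' ∈ T, ‖s (t - t')‖ ≤ r → ‖t - t'‖ ≤ D)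
    {s₀ : E →L[ℝ] F} (hs₀ : s₀ ∈ S) :
    ∃ L : F →L[ℝ] E, (∀ x, s₀ (L x) = x) ∧ ∀ s ∈ S, ∀ x, s (L x) = 0 → x = 0 := by
  have hR : 0 ≤ R := by
    obtain ⟨t, -, h⟩ := hdense s₀ hs₀ 0
    exact (norm_nonneg _).trans h
  obtain ⟨D, hD⟩ := hproper (2 * R + 1)
  have hqi : ∀ s ∈ S, ∀ t ∈ T, ∀ t' ∈ T, ‖t - t'‖ ≤ D * ‖s (t - t')‖ + 2 * D :=
    fun s hs t ht t' ht' => norm_sub_le_of_dense hR (hdense s hs) (hD s hs) ht ht'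
  choose ψ hψT hψ using hdense s₀ hs₀
  have hD0 : 0 ≤ D := by
    have := hD s₀ hs₀ (ψ 0) (hψT 0) (ψ 0) (hψT 0) (by simp; positivity)
    simpa using this
  have hψlip : ∀ x y, ‖ψ x - ψ y‖ ≤ D * ‖x - y‖ + (2 * R * D + 2 * D) := by
    intro x y
    refine (hqi s₀ hs₀ _ (hψT x) _ (hψT y)).trans ?_
    have : ‖s₀ (ψ x - ψ y)‖ ≤ ‖x - y‖ + 2 * R := by
      have e : s₀ (ψ x - ψ y) = (s₀ (ψ x) - x) - (s₀ (ψ y) - y) + (x - y) := by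
        rw [map_sub]; abel
      rw [e]
      have h1 := norm_add_le ((s₀ (ψ x) - x) - (s₀ (ψ y) - y)) (x - y)
      have h2 := norm_sub_le (s₀ (ψ x) - x) (s₀ (ψ y) - y)
      linarith [hψ x, hψ y]
    nlinarith
  -- Rescalings of the coarse section; the limit is taken along a nonprincipal ultrafilter, so that
  -- it exists at all `x` simultaneously.
  let ψn : ℕ → F → E := fun n x => ((n : ℝ) + 1)⁻¹ • ψ (((n : ℝ) + 1) • x)
  let l : Filter ℕ := (hyperfilter ℕ : Filter ℕ)
  have hl : l ≤ atTop := by rw [← Nat.cofinite_eq_atTop]; exact hyperfilter_le_cofinite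
  have hinv : Tendsto (fun n : ℕ => ((n : ℝ) + 1)⁻¹) l (𝓝 0) := by
    have := tendsto_one_div_add_atTop_nhds_zero_nat (𝕜 := ℝ)
    simp only [one_div] at this
    exact this.mono_left hl
  have hpos : ∀ n : ℕ, (0 : ℝ) < (n : ℝ) + 1 := fun n => by positivity
  have hlim : ∀ x, ∃ y, Tendsto (fun n => ψn n x) l (𝓝 y) := by
    intro x
    set B := ‖ψ 0‖ + D * ‖x‖ + (2 * R * D + 2 * D)
    have hb : ∀ n, ψn n x ∈ Metric.closedBall (0 : E) B := by
      intro n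
      rw [mem_closedBall_zero_iff]
      have h1 : ‖ψ (((n : ℝ) + 1) • x)‖ ≤
          ‖ψ 0‖ + D * (((n : ℝ) + 1) * ‖x‖) + (2 * R * D + 2 * D) := by
        have h2 := hψlip (((n : ℝ) + 1) • x) 0
        rw [sub_zero, norm_smul, Real.norm_of_nonneg (hpos n).le] at h2
        have h3 := norm_sub_norm_le (ψ (((n : ℝ) + 1) • x)) (ψ 0)
        linarith
      simp only [ψn]
      rw [norm_smul, norm_inv, Real.norm_of_nonneg (hpos n).le, inv_mul_le_iff₀ (hpos n)]
      refine h1.trans ?_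
      have h4 : 0 ≤ (n : ℝ) * (‖ψ 0‖ + (2 * R * D + 2 * D)) := by positivity
      simp only [B]
      nlinarith
    have hcpt := isCompact_closedBall (0 : E) B
    obtain ⟨y, -, hy⟩ := hcpt.ultrafilter_le_nhds ((hyperfilter ℕ).map fun n => ψn n x)
      (by rw [le_principal_iff]; exact Filter.mem_map.2 (Filter.univ_mem' hb))
    exact ⟨y, hy⟩
  choose φ hφ using hlim
  have hscale : ∀ n x y, ψn n x - ψn n y =
      ((n : ℝ) + 1)⁻¹ • (ψ (((n : ℝ) + 1) • x) - ψ (((n : ℝ) + 1) • y)) := by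
    intro n x y; simp only [ψn]; rw [smul_sub]
  have hzero : ∀ c : ℝ, Tendsto (fun n : ℕ => ((n : ℝ) + 1)⁻¹ * c) l (𝓝 0) := by
    intro c; simpa using hinv.mul_const c
  -- Rescaling kills the additive constant `2 * D` of the quasi-isometry bound; only the Lipschitz
  -- part survives.
  have hφs : ∀ s ∈ S, ∀ x y, ‖φ x - φ y‖ ≤ D * ‖s (φ x - φ y)‖ := by
    intro s hs x y
    have h1 := ((hφ x).sub (hφ y)).norm
    have h2 : Tendsto (fun n => D * ‖s (ψn n x - ψn n y)‖ + ((n : ℝ) + 1)⁻¹ * (2 * D)) l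
        (𝓝 (D * ‖s (φ x - φ y)‖ + 0)) :=
      (((s.continuous.tendsto _).comp ((hφ x).sub (hφ y))).norm.const_mul D).add (hzero _)
    rw [add_zero] at h2
    refine le_of_tendsto_of_tendsto h1 h2 (Eventually.of_forall fun n => ?_)
    dsimp only
    rw [hscale, map_smul, norm_smul, norm_smul, norm_inv, Real.norm_of_nonneg (hpos n).le]
    have := hqi s hs _ (hψT (((n : ℝ) + 1) • x)) _ (hψT (((n : ℝ) + 1) • y))
    calc _ ≤ ((n : ℝ) + 1)⁻¹ * (D * ‖s (ψ (((n : ℝ) + 1) • x) - ψ (((n : ℝ) + 1) • y))‖ + 2 * D) := by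
          gcongr
      _ = _ := by ring
  have hφ0 : ∀ x, s₀ (φ x) = x := by
    intro x
    have h1 : Tendsto (fun n => s₀ (ψn n x)) l (𝓝 (s₀ (φ x))) :=
      (s₀.continuous.tendsto _).comp (hφ x)
    refine tendsto_nhds_unique h1 ?_
    rw [tendsto_iff_norm_sub_tendsto_zero]
    refine squeeze_zero (fun _ => norm_nonneg _) (fun n => ?_) (hzero R)
    have : s₀ (ψn n x) - x = ((n : ℝ) + 1)⁻¹ • (s₀ (ψ (((n : ℝ) + 1) • x)) - ((n : ℝ) + 1) • x) := by
      simp only [ψn]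
      rw [smul_sub, map_smul, smul_smul, inv_mul_cancel₀ (hpos n).ne', one_smul]
    rw [this, norm_smul, norm_inv, Real.norm_of_nonneg (hpos n).le]
    have := hpos n
    gcongr
    exact hψ _
  have hlip : LipschitzWith D.toNNReal φ := by
    refine LipschitzWith.of_dist_le_mul fun x y => ?_
    rw [dist_eq_norm, dist_eq_norm, Real.coe_toNNReal _ hD0]
    simpa [hφ0] using hφs s₀ hs₀ x y
  let _ : MeasurableSpace F := borel F
  have _ : BorelSpace F := ⟨rfl⟩
  -- Rademacher's theorem: differentiability almost everywhere gives at least one point.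
  obtain ⟨x₀, hx₀⟩ := (hlip.ae_differentiableAt (μ := MeasureTheory.Measure.addHaar)).exists
  have hder := hx₀.hasFDerivAt
  have hsec : ∀ x, s₀ (fderiv ℝ φ x₀ x) = x := by
    intro x
    have h1 : HasFDerivAt (fun x => s₀ (φ x)) (s₀.comp (fderiv ℝ φ x₀)) x₀ :=
      s₀.hasFDerivAt.comp x₀ hder
    simp only [hφ0] at h1
    simpa using DFunLike.congr_fun (h1.unique (hasFDerivAt_id x₀)) x
  refine ⟨fderiv ℝ φ x₀, hsec, fun s hs x hx => ?_⟩
  have ht := (hder.hasLineDerivAt x).tendsto_slope_zero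
  -- Difference quotients of `φ` inherit the lower bound of `hφs`, which is homogeneous, and pass it
  -- to the derivative for every `s` at once.
  have h2 : ‖fderiv ℝ φ x₀ x‖ ≤ D * ‖s (fderiv ℝ φ x₀ x)‖ := by
    refine le_of_tendsto_of_tendsto ht.norm
      (((s.continuous.tendsto _).comp ht).norm.const_mul D) (Eventually.of_forall fun t => ?_)
    simp only [Function.comp_apply]
    rw [map_smul, norm_smul, norm_smul]
    have := hφs s hs (x₀ + t • x) x₀
    calc _ ≤ ‖t⁻¹‖ * (D * ‖s (φ (x₀ + t • x) - φ x₀)‖) := by gcongr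
      _ = _ := by ring
  rw [hx, norm_zero, mul_zero, norm_le_zero_iff] at h2
  rw [← hsec x, h2, map_zero]

end CoarseToLinear

open Matrix Topology

attribute [local instance] Matrix.linftyOpNormedAddCommGroup Matrix.linftyOpNormedSpace
  Matrix.linftyOpNormedRing Matrix.linftyOpNormedAlgebra

/-! ## The orthogonal groups and their Lie algebras in terms of the signature matrix -/

/-- The Gram matrix of `indefiniteForm p q`. -/
def signature (p q : ℕ) : Matrix (Fin p ⊕ Fin q) (Fin p ⊕ Fin q) ℝ :=
  Matrix.diagonal (Sum.elim (fun _ => 1) fun _ => -1)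

theorem signature_mul_self (p q : ℕ) : signature p q * signature p q = 1 := by
  rw [signature, Matrix.diagonal_mul_diagonal, ← Matrix.diagonal_one]
  congr 1
  ext (i | i) <;> simp

theorem signature_transpose (p q : ℕ) : (signature p q)ᵀ = signature p q :=
  Matrix.diagonal_transpose _

theorem indefiniteForm_eq (p q : ℕ) (x : Fin p ⊕ Fin q → ℝ) :
    indefiniteForm p q x = x ⬝ᵥ (signature p q *ᵥ x) := by
  simp [indefiniteForm, signature, Matrix.mulVec_diagonal, dotProduct, sq, sub_eq_add_neg]

/-- Polarisation: basis vectors kill the diagonal, and sums of two of them kill the other entries by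
symmetry. -/
theorem eq_zero_of_quadratic_eq_zero {n : Type*} [Fintype n] [DecidableEq n]
    {A : Matrix n n ℝ} (hA : Aᵀ = A) (h : ∀ x, x ⬝ᵥ (A *ᵥ x) = 0) : A = 0 := by
  have hdiag : ∀ i, A i i = 0 := fun i => by simpa using h (Pi.single i 1)
  ext i j
  have h1 := h (Pi.single i 1 + Pi.single j 1)
  have h2 : A j i = A i j := congrFun (congrFun hA i) j
  simp only [Matrix.mulVec_add, add_dotProduct, dotProduct_add, single_dotProduct,
    Matrix.mulVec_single_one, Matrix.col_apply, one_mul, hdiag, h2] at h1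
  simp only [Matrix.zero_apply]
  linarith

theorem mem_indefiniteOrthogonal_iff {p q : ℕ} {g : GL (Fin p ⊕ Fin q) ℝ} :
    g ∈ indefiniteOrthogonal p q ↔
      g.valᵀ * signature p q * g.val = signature p q := by
  have key : ∀ x, indefiniteForm p q (g.val *ᵥ x) =
      x ⬝ᵥ ((g.valᵀ * signature p q * g.val) *ᵥ x) := by
    intro x
    rw [indefiniteForm_eq, ← Matrix.mulVec_mulVec, ← Matrix.mulVec_mulVec,
      Matrix.dotProduct_mulVec x, Matrix.vecMul_transpose]
  constructor
  · intro h
    rw [← sub_eq_zero]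
    refine eq_zero_of_quadratic_eq_zero ?_ fun x => ?_
    · simp [Matrix.transpose_mul, signature_transpose, mul_assoc]
    · rw [Matrix.sub_mulVec, dotProduct_sub, ← key, ← indefiniteForm_eq, h x, sub_self]
  · intro h x
    rw [key, h, indefiniteForm_eq]

/-- Conjugation by the signature `J` sends `X` to `-X`, hence `exp X` to its inverse. -/
theorem exp_mul_signature_mul_exp {p q : ℕ} {X : Matrix (Fin p ⊕ Fin q) (Fin p ⊕ Fin q) ℝ}
    (h : signature p q * X = -(X * signature p q)) :
    NormedSpace.exp X * signature p q * NormedSpace.exp X = signature p q := by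
  let U : (Matrix (Fin p ⊕ Fin q) (Fin p ⊕ Fin q) ℝ)ˣ :=
    ⟨signature p q, signature p q, signature_mul_self p q, signature_mul_self p q⟩
  have h1 := Matrix.exp_units_conj U X
  have h2 : (U : Matrix _ _ ℝ) * X * ((U⁻¹ : (Matrix _ _ ℝ)ˣ) : Matrix _ _ ℝ) = -X := by
    change signature p q * X * signature p q = -X
    rw [h, neg_mul, mul_assoc, signature_mul_self, mul_one]
  rw [h2] at h1
  change NormedSpace.exp (-X) = signature p q * NormedSpace.exp X * signature p q at h1
  have h3 : NormedSpace.exp (-X) * NormedSpace.exp X = 1 := by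
    rw [← Matrix.exp_add_of_commute _ _ (Commute.neg_left (Commute.refl X)), neg_add_cancel,
      NormedSpace.exp_zero]
  rw [h1] at h3
  calc _ = signature p q * (signature p q * NormedSpace.exp X * signature p q *
        NormedSpace.exp X) := by
        rw [mul_assoc, mul_assoc, mul_assoc, ← mul_assoc (signature p q) (signature p q),
          signature_mul_self, one_mul]
    _ = _ := by rw [h3, mul_one]

theorem hasDerivAt_exp_smul_zero {n : Type*} [Fintype n] [DecidableEq n] (X : Matrix n n ℝ) :
    HasDerivAt (fun t : ℝ => NormedSpace.exp (t • X)) X 0 := by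
  have := hasDerivAt_exp_smul_const (𝕂 := ℝ) X (0 : ℝ)
  rw [zero_smul, NormedSpace.exp_zero, one_mul] at this
  exact this

/-- Differentiate `exp(tX)ᵀ J exp(tX) = J` at `t = 0` on generators; the resulting condition is
linear, so it extends to the span. -/
theorem transpose_mul_signature_of_mem_lieAlgebra {p q : ℕ}
    {X : Matrix (Fin p ⊕ Fin q) (Fin p ⊕ Fin q) ℝ}
    (hX : X ∈ lieAlgebra (indefiniteOrthogonal p q)) :
    Xᵀ * signature p q + signature p q * X = 0 := by
  induction hX using Submodule.span_induction with
  | mem X hX =>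
    have h1 := hasDerivAt_exp_smul_zero X
    have h2 := hasDerivAt_exp_smul_zero Xᵀ
    have h3 := (h2.mul_const (signature p q)).mul h1
    have h4 : (fun t : ℝ => NormedSpace.exp (t • Xᵀ) * signature p q * NormedSpace.exp (t • X)) =
        fun _ => signature p q := by
      ext1 t
      obtain ⟨g, hg, e⟩ := hX t
      rw [mem_indefiniteOrthogonal_iff, e, ← Matrix.exp_transpose, Matrix.transpose_smul] at hg
      exact hg
    have h5 := h3.unique (h4 ▸ hasDerivAt_const (0 : ℝ) (signature p q))
    simpa using h5
  | zero => simp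
  | add X Y _ _ hX hY =>
    rw [Matrix.transpose_add, add_mul, mul_add, add_add_add_comm, hX, hY, add_zero]
  | smul c X _ hX => rw [Matrix.transpose_smul, smul_mul_assoc, mul_smul_comm, ← smul_add, hX,
      smul_zero]

theorem exists_mem_indefiniteOrthogonal_eq_exp {p q : ℕ}
    {X : Matrix (Fin p ⊕ Fin q) (Fin p ⊕ Fin q) ℝ} (hX : Xᵀ = X)
    (h : signature p q * X = -(X * signature p q)) (t : ℝ) :
    ∃ g ∈ indefiniteOrthogonal p q,
      g.val = NormedSpace.exp (t • X) := by
  have ht : signature p q * (t • X) = -(t • X * signature p q) := by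
    rw [mul_smul_comm, h, smul_mul_assoc, smul_neg]
  refine ⟨(Matrix.isUnit_exp (t • X)).unit, ?_, IsUnit.unit_spec _⟩
  rw [mem_indefiniteOrthogonal_iff, IsUnit.unit_spec, ← Matrix.exp_transpose,
    Matrix.transpose_smul, hX, exp_mul_signature_mul_exp ht]

/-- Makes `𝔭` explicit: anticommuting with the signature means being block off-diagonal, and such
symmetric matrices are already generators of the Lie algebra. -/
theorem mem_symmetricPart_iff {p q : ℕ} {X : Matrix (Fin p ⊕ Fin q) (Fin p ⊕ Fin q) ℝ} :
    X ∈ symmetricPart (indefiniteOrthogonal p q) ↔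
      Xᵀ = X ∧ signature p q * X = -(X * signature p q) := by
  constructor
  · rintro ⟨h1, h2⟩
    have := transpose_mul_signature_of_mem_lieAlgebra h1
    rw [h2] at this
    exact ⟨h2, eq_neg_of_add_eq_zero_right this⟩
  · rintro ⟨h1, h2⟩
    exact ⟨Submodule.subset_span (exists_mem_indefiniteOrthogonal_eq_exp h1 h2), h1⟩

/-- The base vector `e₀`. -/
abbrev baseVector (p q : ℕ) : Fin (p + 1) ⊕ Fin q → ℝ := Pi.single (Sum.inl 0) 1

theorem mulVec_baseVector_of_mem_lieAlgebra {p q : ℕ}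
    {X : Matrix (Fin (p + 1) ⊕ Fin q) (Fin (p + 1) ⊕ Fin q) ℝ}
    (hX : X ∈ lieAlgebra (indefiniteOrthogonalStabilizer p q)) :
    X *ᵥ baseVector p q = 0 := by
  induction hX using Submodule.span_induction with
  | mem X hX =>
    have h1 := (LinearMap.toContinuousLinearMap
      ((Matrix.mulVecBilin ℝ ℝ).flip (baseVector p q))).hasFDerivAt.comp_hasDerivAt (0 : ℝ)
        (hasDerivAt_exp_smul_zero X)
    have h2 : (fun t : ℝ => NormedSpace.exp (t • X) *ᵥ baseVector p q) =
        fun _ => baseVector p q := by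
      ext1 t
      obtain ⟨g, hg, e⟩ := hX t
      rw [← e]; exact hg.2
    have h3 := hasDerivAt_const (0 : ℝ) (baseVector p q)
    rw [← h2] at h3
    exact h1.unique h3
  | zero => exact Matrix.zero_mulVec _
  | add X Y _ _ hX hY => rw [Matrix.add_mulVec, hX, hY, add_zero]
  | smul c X _ hX => rw [Matrix.smul_mulVec, hX, smul_zero]

theorem exp_smul_mulVec_eq_self {n : Type*} [Fintype n] [DecidableEq n] {X : Matrix n n ℝ}
    {v : n → ℝ} (h : X *ᵥ v = 0) (t : ℝ) : NormedSpace.exp (t • X) *ᵥ v = v := by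
  have hd : ∀ t : ℝ, HasDerivAt (fun t : ℝ => NormedSpace.exp (t • X) *ᵥ v) 0 t := by
    intro t
    have h1 := (LinearMap.toContinuousLinearMap
      ((Matrix.mulVecBilin ℝ ℝ).flip v)).hasFDerivAt.comp_hasDerivAt t
        (hasDerivAt_exp_smul_const (𝕂 := ℝ) X t)
    convert! h1 using 1
    change 0 = (NormedSpace.exp (t • X) * X) *ᵥ v
    rw [← Matrix.mulVec_mulVec, h, Matrix.mulVec_zero]
  have := is_const_of_deriv_eq_zero (fun t => (hd t).differentiableAt) (fun t => (hd t).deriv) t 0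
  simpa using this

theorem mem_lieAlgebra_stabilizer {p q : ℕ}
    {X : Matrix (Fin (p + 1) ⊕ Fin q) (Fin (p + 1) ⊕ Fin q) ℝ}
    (hX : X ∈ symmetricPart (indefiniteOrthogonal (p + 1) q)) (h : X *ᵥ baseVector p q = 0) :
    X ∈ lieAlgebra (indefiniteOrthogonalStabilizer p q) := by
  rw [mem_symmetricPart_iff] at hX
  refine Submodule.subset_span fun t => ?_
  obtain ⟨g, hg, e⟩ := exists_mem_indefiniteOrthogonal_eq_exp hX.1 hX.2 t
  exact ⟨g, ⟨hg, by rw [e]; exact exp_smul_mulVec_eq_self h t⟩, e⟩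

/-! ## The maximal compact subgroup -/

/-- For an orthogonal matrix, preserving the form `J` is the same as commuting with `J`. -/
theorem mem_fixedSubgroup_iff {p q : ℕ} {k : GL (Fin p ⊕ Fin q) ℝ} :
    k ∈ fixedSubgroup (indefiniteOrthogonal p q) ↔
      k.valᵀ * k.val = 1 ∧
        signature p q * k.val = k.val * signature p q := by
  set A : Matrix (Fin p ⊕ Fin q) (Fin p ⊕ Fin q) ℝ := k.val with hA
  have hinv : A * ((k⁻¹ : GL (Fin p ⊕ Fin q) ℝ) : Matrix (Fin p ⊕ Fin q) (Fin p ⊕ Fin q) ℝ) = 1 :=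
    k.mul_inv
  have hinv' : ((k⁻¹ : GL (Fin p ⊕ Fin q) ℝ) : Matrix (Fin p ⊕ Fin q) (Fin p ⊕ Fin q) ℝ) * A = 1 :=
    k.inv_mul
  change _ ∧ Aᵀ = _ ↔ _
  rw [mem_indefiniteOrthogonal_iff]
  constructor
  · rintro ⟨h1, h2⟩
    refine ⟨by rw [h2, hinv'], ?_⟩
    calc signature p q * A = A * Aᵀ * (signature p q * A) := by rw [h2, hinv, one_mul]
      _ = A * (Aᵀ * signature p q * A) := by simp only [mul_assoc]
      _ = _ := by rw [h1]
  · rintro ⟨h1, h2⟩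
    refine ⟨?_, ?_⟩
    · rw [mul_assoc, h2, ← mul_assoc, h1, one_mul]
    · calc Aᵀ = Aᵀ * A * _ := by rw [mul_assoc, hinv, mul_one]
        _ = _ := by rw [h1, one_mul]

/-- Columns of an orthogonal matrix are unit vectors, so the entries are bounded. The inverse is the
transpose, so the map from this compact set of matrices into `GL` is continuous. -/
instance compactSpace_fixedSubgroup (p q : ℕ) :
    CompactSpace (fixedSubgroup (indefiniteOrthogonal p q)) := by
  set C : Set (Matrix (Fin p ⊕ Fin q) (Fin p ⊕ Fin q) ℝ) :=
    {A | Aᵀ * A = 1 ∧ signature p q * A = A * signature p q} with hC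
  have hclosed : IsClosed C := by
    refine IsClosed.and ?_ ?_
    · exact isClosed_eq (by fun_prop) (by fun_prop)
    · exact isClosed_eq (by fun_prop) (by fun_prop)
  have hbdd : Bornology.IsBounded C := by
    have hsub : C ⊆ Set.pi Set.univ fun _ => Set.pi Set.univ fun _ => Set.Icc (-1 : ℝ) 1 := by
      intro A hA i _ j _
      have h1 : ∑ l, A l j * A l j = 1 := by
        have := congrFun (congrFun hA.1 j) j
        simpa [Matrix.mul_apply] using this
      have h2 : A i j * A i j ≤ 1 := by
        rw [← h1]
        exact Finset.single_le_sum (f := fun l => A l j * A l j)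
          (fun l _ => mul_self_nonneg _) (Finset.mem_univ i)
      rw [Set.mem_Icc, ← abs_le, ← sq_le_one_iff_abs_le_one, sq]
      exact h2
    have hcpt : IsCompact (Set.pi Set.univ fun _ => Set.pi Set.univ fun _ => Set.Icc (-1 : ℝ) 1 :
        Set (Matrix (Fin p ⊕ Fin q) (Fin p ⊕ Fin q) ℝ)) :=
      isCompact_univ_pi fun _ => isCompact_univ_pi fun _ => isCompact_Icc
    exact hcpt.isBounded.subset hsub
  have hcpt : IsCompact C := Metric.isCompact_of_isClosed_isBounded hclosed hbdd
  have : CompactSpace C := isCompact_iff_compactSpace.1 hcpt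
  let u : C → GL (Fin p ⊕ Fin q) ℝ := fun A =>
    ⟨A, (A : Matrix _ _ ℝ)ᵀ, mul_eq_one_comm.1 A.2.1, A.2.1⟩
  have hu : Continuous u := by
    rw [Units.continuous_iff]
    exact ⟨continuous_subtype_val, continuous_subtype_val.matrix_transpose⟩
  let f : C → fixedSubgroup (indefiniteOrthogonal p q) := fun A =>
    ⟨u A, mem_fixedSubgroup_iff.2 A.2⟩
  have hf : Continuous f := hu.subtype_mk _
  have hsurj : Function.Surjective f := by
    rintro ⟨k, hk⟩
    exact ⟨⟨k, mem_fixedSubgroup_iff.1 hk⟩, Subtype.ext (Units.ext rfl)⟩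
  exact hsurj.compactSpace hf

/-- The sup norm on vectors is not `K`-invariant; this constant replaces invariance in all later
estimates. -/
theorem exists_norm_fixedSubgroup_le (p q : ℕ) :
    ∃ M : ℝ, 1 ≤ M ∧ ∀ k ∈ fixedSubgroup (indefiniteOrthogonal p q),
      ‖k.val‖ ≤ M := by
  have hc : Continuous fun k : fixedSubgroup (indefiniteOrthogonal p q) =>
      ((k : GL (Fin p ⊕ Fin q) ℝ) : Matrix (Fin p ⊕ Fin q) (Fin p ⊕ Fin q) ℝ) :=
    Units.continuous_val.comp continuous_subtype_val
  obtain ⟨M, hM⟩ := isCompact_univ.exists_bound_of_continuousOn hc.continuousOn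
  exact ⟨max M 1, le_max_right _ _, fun k hk => (hM ⟨k, hk⟩ (Set.mem_univ _)).trans (le_max_left _ _)⟩

theorem dotProduct_mulVec_fixedSubgroup {p q : ℕ} {k : GL (Fin p ⊕ Fin q) ℝ}
    (hk : k ∈ fixedSubgroup (indefiniteOrthogonal p q)) (x y : Fin p ⊕ Fin q → ℝ) :
    (k.val *ᵥ x) ⬝ᵥ
      (k.val *ᵥ y) = x ⬝ᵥ y := by
  rw [← Matrix.vecMul_transpose, ← Matrix.dotProduct_mulVec, Matrix.mulVec_mulVec,
    (mem_fixedSubgroup_iff.1 hk).1, Matrix.one_mulVec]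

/-- Any two vectors of equal length in the `+1`-eigenspace of the signature are related by `K`. -/
theorem exists_fixedSubgroup_mulVec_eq {p q : ℕ} {u v : Fin p ⊕ Fin q → ℝ}
    (hu : signature p q *ᵥ u = u) (hv : signature p q *ᵥ v = v) (h : u ⬝ᵥ u = v ⬝ᵥ v) :
    ∃ k ∈ fixedSubgroup (indefiniteOrthogonal p q),
      k.val *ᵥ u = v := by
  by_cases huv : u = v
  · exact ⟨1, one_mem _, by simp [huv]⟩
  set d := u - v with hd
  have hd0 : d ⬝ᵥ d ≠ 0 := by
    rw [Ne, dotProduct_self_eq_zero, sub_eq_zero]; exact huv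
  have hJd : signature p q *ᵥ d = d := by rw [hd, Matrix.mulVec_sub, hu, hv]
  have hdJ : d ᵥ* signature p q = d := by
    rw [← Matrix.mulVec_transpose, signature_transpose, hJd]
  -- The reflection in the hyperplane orthogonal to `u - v`; it commutes with the signature because
  -- `u - v` is a `+1`-eigenvector.
  set A : Matrix (Fin p ⊕ Fin q) (Fin p ⊕ Fin q) ℝ := 1 - (2 / d ⬝ᵥ d) • vecMulVec d d with hA
  have hAt : Aᵀ = A := by
    rw [hA, Matrix.transpose_sub, Matrix.transpose_smul, Matrix.transpose_vecMulVec,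
      Matrix.transpose_one]
  have hAA : A * A = 1 := by
    have h1 : vecMulVec d d * vecMulVec d d = (d ⬝ᵥ d) • vecMulVec d d := by
      rw [Matrix.vecMulVec_mul_vecMulVec, Matrix.vecMulVec_smul]
    have h2 : (2 / d ⬝ᵥ d) * (2 / d ⬝ᵥ d) * (d ⬝ᵥ d) = 2 * (2 / d ⬝ᵥ d) := by field_simp
    rw [hA, sub_mul, one_mul, mul_sub, mul_one, smul_mul_assoc, mul_smul_comm, h1, smul_smul,
      smul_smul, h2, mul_smul, two_smul]
    abel
  refine ⟨⟨A, A, hAA, hAA⟩, mem_fixedSubgroup_iff.2 ⟨?_, ?_⟩, ?_⟩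
  · change Aᵀ * A = 1
    rw [hAt, hAA]
  · change signature p q * A = A * signature p q
    rw [hA, mul_sub, sub_mul, mul_one, one_mul, mul_smul_comm, smul_mul_assoc,
      Matrix.mul_vecMulVec, Matrix.vecMulVec_mul, hJd, hdJ]
  · change A *ᵥ u = v
    have h3 : 2 * (d ⬝ᵥ u) = d ⬝ᵥ d := by
      simp only [hd, sub_dotProduct, dotProduct_sub]
      rw [dotProduct_comm u v, h]; ring
    rw [hA, Matrix.sub_mulVec, Matrix.one_mulVec, Matrix.smul_mulVec, Matrix.vecMulVec_mulVec,
      op_smul_eq_smul, smul_smul, div_mul_eq_mul_div, h3, div_self hd0, one_smul, hd]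
    abel

/-! ## The tangential symmetric space as a trivial vector bundle over the sphere -/

/-- The Cartan motion group of `O(p+1,q)`. -/
abbrev MotionGroup (p q : ℕ) : Type := CartanMotionGroup (indefiniteOrthogonal (p + 1) q)

/-- The tangential symmetric space of `O(p+1,q) ⧸ O(p,q)`. -/
abbrev TangentialSpace (p q : ℕ) : Type :=
  MotionGroup p q ⧸ tangentialSubgroup (indefiniteOrthogonal (p + 1) q)
    (indefiniteOrthogonalStabilizer p q)

variable {p q : ℕ}

/-- The component of `g` in `K`, as a matrix. -/
def rotationPart (g : MotionGroup p q) : Matrix (Fin (p + 1) ⊕ Fin q) (Fin (p + 1) ⊕ Fin q) ℝ :=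
  g.right.1.val

/-- The component of `g` in `𝔭`, as a matrix. -/
def translationPart (g : MotionGroup p q) :
    Matrix (Fin (p + 1) ⊕ Fin q) (Fin (p + 1) ⊕ Fin q) ℝ :=
  g.left.toAdd.1

theorem rotationPart_mul (g h : MotionGroup p q) :
    rotationPart (g * h) = rotationPart g * rotationPart h := rfl

theorem transpose_rotationPart (g : MotionGroup p q) :
    (rotationPart g)ᵀ = (g.right.1⁻¹).val := g.right.2.2

theorem translationPart_mul (g h : MotionGroup p q) :
    translationPart (g * h) =
      translationPart g + rotationPart g * translationPart h * (rotationPart g)ᵀ := by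
  rw [transpose_rotationPart]; rfl

theorem rotationPart_one : rotationPart (1 : MotionGroup p q) = 1 := rfl

theorem translationPart_one : translationPart (1 : MotionGroup p q) = 0 := rfl

theorem transpose_rotationPart_mul_self (g : MotionGroup p q) :
    (rotationPart g)ᵀ * rotationPart g = 1 := (mem_fixedSubgroup_iff.1 g.right.2).1

theorem rotationPart_mul_transpose_self (g : MotionGroup p q) :
    rotationPart g * (rotationPart g)ᵀ = 1 :=
  mul_eq_one_comm.1 (transpose_rotationPart_mul_self g)

theorem rotationPart_inv (g : MotionGroup p q) : rotationPart g⁻¹ = (rotationPart g)ᵀ := by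
  have h : rotationPart g * rotationPart g⁻¹ = 1 := by
    rw [← rotationPart_mul, mul_inv_cancel, rotationPart_one]
  calc _ = (rotationPart g)ᵀ * rotationPart g * rotationPart g⁻¹ := by
        rw [transpose_rotationPart_mul_self, one_mul]
    _ = _ := by rw [mul_assoc, h, mul_one]

theorem translationPart_inv_mul (g h : MotionGroup p q) :
    translationPart (g⁻¹ * h) =
      (rotationPart g)ᵀ * (translationPart h - translationPart g) * rotationPart g := by
  have e : translationPart h = translationPart (g * (g⁻¹ * h)) := by rw [mul_inv_cancel_left]
  rw [e, translationPart_mul g, add_sub_cancel_left]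
  calc _ = ((rotationPart g)ᵀ * rotationPart g) * translationPart (g⁻¹ * h) *
        ((rotationPart g)ᵀ * rotationPart g) := by
        rw [transpose_rotationPart_mul_self, one_mul, mul_one]
    _ = _ := by simp only [mul_assoc]

theorem continuous_components : Continuous fun g : MotionGroup p q =>
    ((g.left.toAdd, g.right) : symmetricPart (indefiniteOrthogonal (p + 1) q) ×
      fixedSubgroup (indefiniteOrthogonal (p + 1) q)) :=
  continuous_induced_dom

theorem continuous_translationPart : Continuous (translationPart : MotionGroup p q → _) :=
  continuous_subtype_val.comp (continuous_fst.comp continuous_components)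

theorem continuous_rotationPart : Continuous (rotationPart : MotionGroup p q → _) :=
  Units.continuous_val.comp
    (continuous_subtype_val.comp (continuous_snd.comp continuous_components))

/-- The base point `k e₀` of `(X, k) H_θ` in the sphere. -/
def spherePart (g : MotionGroup p q) : Fin (p + 1) ⊕ Fin q → ℝ :=
  rotationPart g *ᵥ baseVector p q

/-- The fibre coordinate `X k e₀` of `(X, k) H_θ`. -/
def fiberPart (g : MotionGroup p q) : Fin (p + 1) ⊕ Fin q → ℝ :=
  translationPart g *ᵥ spherePart g

theorem spherePart_mul (g h : MotionGroup p q) :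
    spherePart (g * h) = rotationPart g *ᵥ spherePart h := by
  rw [spherePart, spherePart, rotationPart_mul, Matrix.mulVec_mulVec]

theorem fiberPart_mul (g h : MotionGroup p q) :
    fiberPart (g * h) = rotationPart g *ᵥ fiberPart h +
      translationPart g *ᵥ (rotationPart g *ᵥ spherePart h) := by
  rw [fiberPart, spherePart_mul, translationPart_mul, Matrix.add_mulVec,
    add_comm (translationPart g *ᵥ _)]
  congr 1
  rw [Matrix.mulVec_mulVec, mul_assoc, transpose_rotationPart_mul_self, mul_one,
    ← Matrix.mulVec_mulVec, fiberPart]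

theorem spherePart_of_mem {h : MotionGroup p q}
    (hh : h ∈ tangentialSubgroup (indefiniteOrthogonal (p + 1) q)
      (indefiniteOrthogonalStabilizer p q)) : spherePart h = baseVector p q := hh.1.2

theorem fiberPart_of_mem {h : MotionGroup p q}
    (hh : h ∈ tangentialSubgroup (indefiniteOrthogonal (p + 1) q)
      (indefiniteOrthogonalStabilizer p q)) : fiberPart h = 0 := by
  rw [fiberPart, spherePart_of_mem hh]
  exact mulVec_baseVector_of_mem_lieAlgebra hh.2

/-- The base point of an element of the tangential symmetric space. -/
def spherePoint : TangentialSpace p q → (Fin (p + 1) ⊕ Fin q → ℝ) :=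
  Quotient.lift spherePart fun g h hgh => by
    rw [← mul_inv_cancel_left g h, spherePart_mul,
      spherePart_of_mem (QuotientGroup.leftRel_apply.1 hgh), spherePart]

/-- The fibre coordinate of an element of the tangential symmetric space. -/
def fiberPoint : TangentialSpace p q → (Fin (p + 1) ⊕ Fin q → ℝ) :=
  Quotient.lift fiberPart fun g h hgh => by
    have hm := QuotientGroup.leftRel_apply.1 hgh
    rw [← mul_inv_cancel_left g h, fiberPart_mul, spherePart_of_mem hm, fiberPart_of_mem hm,
      Matrix.mulVec_zero, zero_add, fiberPart, spherePart]

theorem continuous_spherePart : Continuous (spherePart : MotionGroup p q → _) :=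
  continuous_rotationPart.matrix_mulVec continuous_const

theorem continuous_fiberPart : Continuous (fiberPart : MotionGroup p q → _) :=
  continuous_translationPart.matrix_mulVec continuous_spherePart

theorem continuous_spherePoint : Continuous (spherePoint : TangentialSpace p q → _) :=
  continuous_spherePart.quotient_lift _

theorem continuous_fiberPoint : Continuous (fiberPoint : TangentialSpace p q → _) :=
  continuous_fiberPart.quotient_lift _

theorem fiberPoint_smul (γ : MotionGroup p q) (x : TangentialSpace p q) :
    fiberPoint (γ • x) = rotationPart γ *ᵥ fiberPoint x +
      translationPart γ *ᵥ (rotationPart γ *ᵥ spherePoint x) := by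
  induction x using QuotientGroup.induction_on with
  | H g => exact fiberPart_mul γ g

theorem norm_baseVector : ‖baseVector p q‖ = 1 := by
  rw [baseVector, Pi.norm_single, norm_one]

theorem signature_mulVec_baseVector :
    signature (p + 1) q *ᵥ baseVector p q = baseVector p q := by
  ext (i | i) <;> simp [signature, Matrix.mulVec_diagonal]

theorem signature_mulVec_rotationPart (g : MotionGroup p q) {v : Fin (p + 1) ⊕ Fin q → ℝ}
    (hv : signature (p + 1) q *ᵥ v = v) :
    signature (p + 1) q *ᵥ (rotationPart g *ᵥ v) = rotationPart g *ᵥ v := by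
  have := (mem_fixedSubgroup_iff.1 g.right.2).2
  change signature (p + 1) q * rotationPart g = rotationPart g * signature (p + 1) q at this
  rw [Matrix.mulVec_mulVec, this, ← Matrix.mulVec_mulVec, hv]

theorem signature_mulVec_symmetricPart
    {X : Matrix (Fin (p + 1) ⊕ Fin q) (Fin (p + 1) ⊕ Fin q) ℝ}
    (hX : X ∈ symmetricPart (indefiniteOrthogonal (p + 1) q)) {v : Fin (p + 1) ⊕ Fin q → ℝ}
    (hv : signature (p + 1) q *ᵥ v = v) :
    signature (p + 1) q *ᵥ (X *ᵥ v) = -(X *ᵥ v) := by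
  rw [Matrix.mulVec_mulVec, (mem_symmetricPart_iff.1 hX).2, Matrix.neg_mulVec,
    ← Matrix.mulVec_mulVec, hv]

theorem signature_mulVec_spherePart (g : MotionGroup p q) :
    signature (p + 1) q *ᵥ spherePart g = spherePart g :=
  signature_mulVec_rotationPart g signature_mulVec_baseVector

theorem signature_mulVec_fiberPart (g : MotionGroup p q) :
    signature (p + 1) q *ᵥ fiberPart g = -fiberPart g :=
  signature_mulVec_symmetricPart g.left.toAdd.2 (signature_mulVec_spherePart g)

theorem spherePart_dotProduct_self (g : MotionGroup p q) : spherePart g ⬝ᵥ spherePart g = 1 := by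
  have := dotProduct_mulVec_fixedSubgroup g.right.2 (baseVector p q) (baseVector p q)
  exact this.trans (by simp)

theorem norm_rotationPart_le (p q : ℕ) :
    ∃ M : ℝ, 1 ≤ M ∧ ∀ g : MotionGroup p q, ‖rotationPart g‖ ≤ M ∧ ‖(rotationPart g)ᵀ‖ ≤ M := by
  obtain ⟨M, hM, h⟩ := exists_norm_fixedSubgroup_le (p + 1) q
  refine ⟨M, hM, fun g => ⟨h _ g.right.2, ?_⟩⟩
  rw [← rotationPart_inv]
  exact h _ (g⁻¹).right.2

/-- The rank-two matrix `w vᵀ + v wᵀ` is an element of `𝔭` that sends a unit vector `v` to `w` and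
depends continuously on `(v, w)`. -/
theorem vecMulVec_mem_symmetricPart {v w : Fin (p + 1) ⊕ Fin q → ℝ}
    (hv : signature (p + 1) q *ᵥ v = v) (hw : signature (p + 1) q *ᵥ w = -w) :
    vecMulVec w v + vecMulVec v w ∈ symmetricPart (indefiniteOrthogonal (p + 1) q) := by
  have hv' : v ᵥ* signature (p + 1) q = v := by
    rw [← Matrix.mulVec_transpose, signature_transpose, hv]
  have hw' : w ᵥ* signature (p + 1) q = -w := by
    rw [← Matrix.mulVec_transpose, signature_transpose, hw]
  rw [mem_symmetricPart_iff]
  constructor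
  · rw [Matrix.transpose_add, Matrix.transpose_vecMulVec, Matrix.transpose_vecMulVec,
      add_comm (vecMulVec v w)]
  · rw [mul_add, add_mul, Matrix.mul_vecMulVec, Matrix.mul_vecMulVec, Matrix.vecMulVec_mul,
      Matrix.vecMulVec_mul, hv, hw, hv', hw', Matrix.neg_vecMulVec, Matrix.vecMulVec_neg]
    abel

theorem dotProduct_eq_zero_of_signature {v w : Fin (p + 1) ⊕ Fin q → ℝ}
    (hv : signature (p + 1) q *ᵥ v = v) (hw : signature (p + 1) q *ᵥ w = -w) : w ⬝ᵥ v = 0 := by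
  have h : w ⬝ᵥ v = -(w ⬝ᵥ v) := by
    conv_lhs => rw [← hv, Matrix.dotProduct_mulVec, ← Matrix.mulVec_transpose,
      signature_transpose, hw, neg_dotProduct]
  linarith

theorem vecMulVec_add_mulVec {v w : Fin (p + 1) ⊕ Fin q → ℝ}
    (hv : signature (p + 1) q *ᵥ v = v) (hw : signature (p + 1) q *ᵥ w = -w) (h : v ⬝ᵥ v = 1) :
    (vecMulVec w v + vecMulVec v w) *ᵥ v = w := by
  rw [Matrix.add_mulVec, Matrix.vecMulVec_mulVec, Matrix.vecMulVec_mulVec, h,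
    dotProduct_eq_zero_of_signature hv hw]
  simp

/-- The homogeneous space is all of the bundle. -/
theorem exists_spherePart_fiberPart_eq {v w : Fin (p + 1) ⊕ Fin q → ℝ}
    (hv : signature (p + 1) q *ᵥ v = v) (hw : signature (p + 1) q *ᵥ w = -w) (h : v ⬝ᵥ v = 1) :
    ∃ g : MotionGroup p q, spherePart g = v ∧ fiberPart g = w := by
  obtain ⟨k, hk, hkv⟩ := exists_fixedSubgroup_mulVec_eq
    (signature_mulVec_baseVector (p := p) (q := q)) hv (by rw [h]; simp)
  let g : MotionGroup p q :=
    ⟨Multiplicative.ofAdd ⟨_, vecMulVec_mem_symmetricPart hv hw⟩, ⟨k, hk⟩⟩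
  have h1 : spherePart g = v := hkv
  refine ⟨g, h1, ?_⟩
  rw [fiberPart, h1]
  exact vecMulVec_add_mulVec hv hw h

theorem isCompact_setOf_norm_translationPart_le (r : ℝ) :
    IsCompact {g : MotionGroup p q | ‖translationPart g‖ ≤ r} := by
  have hind : IsInducing fun g : MotionGroup p q =>
      ((g.left.toAdd, g.right) : symmetricPart (indefiniteOrthogonal (p + 1) q) ×
        fixedSubgroup (indefiniteOrthogonal (p + 1) q)) := ⟨rfl⟩
  have : ProperSpace (symmetricPart (indefiniteOrthogonal (p + 1) q)) :=
    FiniteDimensional.proper ℝ _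
  have hK := (isCompact_closedBall (0 : symmetricPart (indefiniteOrthogonal (p + 1) q)) r).prod
    (isCompact_univ (X := fixedSubgroup (indefiniteOrthogonal (p + 1) q)))
  have := (hind.isCompact_preimage_iff (K := Metric.closedBall 0 r ×ˢ Set.univ)
    fun x _ => ⟨⟨Multiplicative.ofAdd x.1, x.2⟩, rfl⟩).2 hK
  convert! this using 1
  ext g
  simp only [Set.mem_ofPred_eq, Set.mem_preimage, Set.mem_prod, Set.mem_univ, and_true,
    mem_closedBall_zero_iff]
  rfl

/-- Sets with bounded fibre coordinate are relatively compact. -/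
theorem exists_isCompact_of_norm_fiberPart_le (p q : ℕ) (r : ℝ) :
    ∃ C : Set (TangentialSpace p q), IsCompact C ∧
      ∀ g : MotionGroup p q, ‖fiberPart g‖ ≤ r → (QuotientGroup.mk g : TangentialSpace p q) ∈ C := by
  obtain ⟨M, hM, hrot⟩ := norm_rotationPart_le p q
  have hcpt := (isCompact_closedBall (0 : Fin (p + 1) ⊕ Fin q → ℝ) M).prod
    (isCompact_closedBall (0 : Fin (p + 1) ⊕ Fin q → ℝ) r)
  have hcont : Continuous fun x : (Fin (p + 1) ⊕ Fin q → ℝ) × (Fin (p + 1) ⊕ Fin q → ℝ) =>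
      vecMulVec x.2 x.1 + vecMulVec x.1 x.2 :=
    (continuous_snd.matrix_vecMulVec continuous_fst).add
      (continuous_fst.matrix_vecMulVec continuous_snd)
  obtain ⟨D, hD⟩ := hcpt.exists_bound_of_continuousOn hcont.continuousOn
  refine ⟨QuotientGroup.mk '' {g | ‖translationPart g‖ ≤ D},
    (isCompact_setOf_norm_translationPart_le D).image continuous_quot_mk, fun g hg => ?_⟩
  have hs := signature_mulVec_spherePart g
  have hf := signature_mulVec_fiberPart g
  set X : symmetricPart (indefiniteOrthogonal (p + 1) q) :=
    ⟨_, vecMulVec_mem_symmetricPart hs hf⟩ with hX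
  -- Chosen so that `g * h` has translation part `X`. Since `X` and the translation part of `g`
  -- agree on `spherePart g`, `Z` kills `e₀` and `h` lies in `H_θ`.
  set Z := Ad (indefiniteOrthogonal (p + 1) q) g.right⁻¹ (X - g.left.toAdd) with hZ
  let h : MotionGroup p q := ⟨Multiplicative.ofAdd Z, 1⟩
  have hh : h ∈ tangentialSubgroup (indefiniteOrthogonal (p + 1) q)
      (indefiniteOrthogonalStabilizer p q) := by
    refine ⟨one_mem (indefiniteOrthogonalStabilizer p q), mem_lieAlgebra_stabilizer Z.2 ?_⟩
    change (rotationPart g⁻¹ * ((X : Matrix _ _ ℝ) - translationPart g) * (_ : Matrix _ _ ℝ)) *ᵥ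
      baseVector p q = 0
    have e : (((g.right⁻¹ : fixedSubgroup (indefiniteOrthogonal (p + 1) q)).1)⁻¹).val =
        rotationPart g := by
      rw [Subgroup.coe_inv, inv_inv]; rfl
    rw [e, ← Matrix.mulVec_mulVec, ← Matrix.mulVec_mulVec, Matrix.sub_mulVec]
    change _ *ᵥ (_ *ᵥ spherePart g - fiberPart g) = 0
    rw [hX, vecMulVec_add_mulVec hs hf (spherePart_dotProduct_self g), sub_self,
      Matrix.mulVec_zero]
  refine ⟨g * h, ?_, QuotientGroup.mk_mul_of_mem g hh⟩
  have hgh : translationPart (g * h) = X.1 := by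
    change ((g.left.toAdd + Ad (indefiniteOrthogonal (p + 1) q) g.right Z :
      symmetricPart (indefiniteOrthogonal (p + 1) q)) : Matrix _ _ ℝ) = X.1
    rw [hZ, ← Ad_mul, mul_inv_cancel, Ad_one, add_sub_cancel]
  rw [Set.mem_ofPred_eq, hgh]
  refine hD (spherePart g, fiberPart g) ⟨?_, by simpa using hg⟩
  rw [mem_closedBall_zero_iff]
  change ‖rotationPart g *ᵥ baseVector p q‖ ≤ M
  refine (Matrix.linfty_opNorm_mulVec _ _).trans ?_
  rw [norm_baseVector, mul_one]
  exact (hrot g).1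

/-! ### Splitting vectors into upper and lower coordinates -/

theorem signature_eq_fromBlocks (p q : ℕ) :
    signature p q = Matrix.fromBlocks 1 0 0 (-1) := by
  ext (i | i) (j | j) <;> simp [signature, Matrix.diagonal_apply, Matrix.one_apply, apply_ite]

theorem signature_mulVec (x : Fin p ⊕ Fin q → ℝ) :
    signature p q *ᵥ x = Sum.elim (x ∘ Sum.inl) (-(x ∘ Sum.inr)) := by
  rw [signature_eq_fromBlocks, Matrix.fromBlocks_mulVec]
  simp [Matrix.neg_mulVec]

theorem eq_elim_of_signature_mulVec_eq {x : Fin p ⊕ Fin q → ℝ} (h : signature p q *ᵥ x = x) :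
    x = Sum.elim (x ∘ Sum.inl) 0 := by
  ext (i | i)
  · rfl
  · have := congrFun h (Sum.inr i)
    simp only [signature_mulVec, Sum.elim_inr, Pi.neg_apply, Function.comp_apply] at this
    simp only [Sum.elim_inr, Pi.zero_apply]
    linarith

theorem eq_elim_of_signature_mulVec_eq_neg {x : Fin p ⊕ Fin q → ℝ}
    (h : signature p q *ᵥ x = -x) : x = Sum.elim (0 : Fin p → ℝ) (x ∘ Sum.inr) := by
  ext (i | i)
  · have := congrFun h (Sum.inl i)
    simp only [signature_mulVec, Sum.elim_inl, Pi.neg_apply, Function.comp_apply] at this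
    simp only [Sum.elim_inl, Pi.zero_apply]
    linarith
  · rfl

theorem norm_elim_zero_left (w : Fin q → ℝ) : ‖(Sum.elim 0 w : Fin p ⊕ Fin q → ℝ)‖ = ‖w‖ := by
  refine le_antisymm ((pi_norm_le_iff_of_nonneg (norm_nonneg _)).2 ?_)
    ((pi_norm_le_iff_of_nonneg (norm_nonneg _)).2 fun i => ?_)
  · rintro (i | i)
    · simp
    · exact norm_le_pi_norm w i
  · exact norm_le_pi_norm (Sum.elim 0 w : Fin p ⊕ Fin q → ℝ) (Sum.inr i)

theorem norm_elim_zero_right (v : Fin p → ℝ) : ‖(Sum.elim v 0 : Fin p ⊕ Fin q → ℝ)‖ = ‖v‖ := by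
  refine le_antisymm ((pi_norm_le_iff_of_nonneg (norm_nonneg _)).2 ?_)
    ((pi_norm_le_iff_of_nonneg (norm_nonneg _)).2 fun i => ?_)
  · rintro (i | i)
    · exact norm_le_pi_norm v i
    · simp
  · exact norm_le_pi_norm (Sum.elim v 0 : Fin p ⊕ Fin q → ℝ) (Sum.inl i)

/-! ## From a compact Clifford–Klein form to a bilinear map -/

/-- Cocompactness: every orbit meets a fixed bounded part of the bundle. -/
theorem exists_norm_fiberPart_mul_le {Γ : Subgroup (MotionGroup p q)}
    (hc : CompactSpace (Quotient (MulAction.orbitRel Γ (TangentialSpace p q)))) :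
    ∃ R : ℝ, ∀ g : MotionGroup p q, ∃ γ ∈ Γ, ‖fiberPart (γ * g)‖ ≤ R := by
  let π : TangentialSpace p q → Quotient (MulAction.orbitRel Γ (TangentialSpace p q)) :=
    Quotient.mk _
  -- The images of the tubes of radius `n` about the zero section form an increasing open cover of
  -- the compact quotient, so one of them is everything.
  let V : ℕ → Set (Quotient (MulAction.orbitRel Γ (TangentialSpace p q))) := fun n =>
    π '' {x | ‖fiberPoint x‖ < n}
  have hpre : ∀ n, π ⁻¹' V n = ⋃ γ : Γ, {x | ‖fiberPoint (γ • x)‖ < n} := by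
    intro n
    ext x
    simp only [V, Set.mem_preimage, Set.mem_image, Set.mem_ofPred_eq, Set.mem_iUnion]
    constructor
    · rintro ⟨y, hy, hyx⟩
      obtain ⟨γ, hγ⟩ := MulAction.orbitRel_apply.1 (Quotient.exact hyx)
      exact ⟨γ, by rw [← hγ] at hy; exact hy⟩
    · rintro ⟨γ, hγ⟩
      exact ⟨γ • x, hγ, Quotient.sound (MulAction.orbitRel_apply.2 ⟨γ, rfl⟩)⟩
  have hopen : ∀ n, IsOpen (V n) := by
    intro n
    have : IsOpen (π ⁻¹' V n) := by
      rw [hpre]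
      refine isOpen_iUnion fun γ => isOpen_lt (Continuous.norm ?_) continuous_const
      have : (fun x : TangentialSpace p q => fiberPoint (γ • x)) = fun x =>
          rotationPart γ.1 *ᵥ fiberPoint x +
            translationPart γ.1 *ᵥ (rotationPart γ.1 *ᵥ spherePoint x) :=
        funext fun x => fiberPoint_smul γ.1 x
      rw [this]
      exact (continuous_const.matrix_mulVec continuous_fiberPoint).add
        (continuous_const.matrix_mulVec
          (continuous_const.matrix_mulVec continuous_spherePoint))
    exact this
  have hmono : Monotone V := by
    intro m n hmn
    refine Set.image_mono fun x hx => ?_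
    have hx' : ‖fiberPoint x‖ < m := hx
    exact hx'.trans_le (by exact_mod_cast hmn)
  obtain ⟨n, hn⟩ := isCompact_univ.elim_directed_cover V hopen (fun y _ => by
    obtain ⟨x, rfl⟩ := Quotient.exists_rep y
    obtain ⟨n, hn⟩ := exists_nat_gt ‖fiberPoint x‖
    exact Set.mem_iUnion.2 ⟨n, x, hn, rfl⟩) hmono.directed_le
  refine ⟨n, fun g => ?_⟩
  have h1 : (QuotientGroup.mk g : TangentialSpace p q) ∈ π ⁻¹' V n := hn (Set.mem_univ _)
  rw [hpre] at h1
  obtain ⟨γ, hγ⟩ := Set.mem_iUnion.1 h1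
  exact ⟨γ.1, γ.2, le_of_lt hγ⟩

/-- Proper discontinuity: only boundedly many translation parts are close to each other in some
direction of the sphere. -/
theorem exists_norm_translationPart_sub_le {Γ : Subgroup (MotionGroup p q)}
    (hΓ : ProperlyDiscontinuousSMul Γ (TangentialSpace p q)) (r : ℝ) :
    ∃ D : ℝ, ∀ v : Fin (p + 1) ⊕ Fin q → ℝ, signature (p + 1) q *ᵥ v = v → v ⬝ᵥ v = 1 →
      ∀ γ ∈ Γ, ∀ γ' ∈ Γ, ‖(translationPart γ - translationPart γ') *ᵥ v‖ ≤ r →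
        ‖translationPart γ - translationPart γ'‖ ≤ D := by
  obtain ⟨M, hM, hrot⟩ := norm_rotationPart_le p q
  obtain ⟨C, hC, hmem⟩ := exists_isCompact_of_norm_fiberPart_le p q (M * r)
  have hfin := hΓ.finite_disjoint_inter_image hC hC
  obtain ⟨D, hD⟩ := (hfin.image fun γ : Γ => ‖translationPart γ.1‖).bddAbove
  refine ⟨M * D * M, fun v hv hv1 γ hγ γ' hγ' h => ?_⟩
  have hr : 0 ≤ r := (norm_nonneg _).trans h
  -- `δ` moves the zero vector over `k'⁻¹ v` to the vector `-k⁻¹ (X - X') v` over `k⁻¹ v`, where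
  -- `(X, k) = γ` and `(X', k') = γ'`. Both points lie in `C`, so there are finitely many such `δ`;
  -- conjugating by `k` costs the factors `M`.
  set δ := γ⁻¹ * γ' with hδ
  have hδΓ : δ ∈ Γ := Γ.mul_mem (Γ.inv_mem hγ) hγ'
  have hv' : signature (p + 1) q *ᵥ (rotationPart γ'⁻¹ *ᵥ v) = rotationPart γ'⁻¹ *ᵥ v :=
    signature_mulVec_rotationPart _ hv
  obtain ⟨g, hg1, hg2⟩ := exists_spherePart_fiberPart_eq hv' (w := 0) (by simp)
    (by rw [← hv1]; exact dotProduct_mulVec_fixedSubgroup (γ'⁻¹).right.2 v v)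
  have hsph : rotationPart δ *ᵥ spherePart g = (rotationPart γ)ᵀ *ᵥ v := by
    rw [hg1, hδ, rotationPart_mul, rotationPart_inv, rotationPart_inv, Matrix.mulVec_mulVec,
      mul_assoc, rotationPart_mul_transpose_self, mul_one]
  have hfib : fiberPart (δ * g) = -((rotationPart γ)ᵀ *ᵥ
      ((translationPart γ - translationPart γ') *ᵥ v)) := by
    rw [fiberPart_mul, hsph, hg2, Matrix.mulVec_zero, zero_add, hδ, translationPart_inv_mul,
      Matrix.mulVec_mulVec, mul_assoc, rotationPart_mul_transpose_self, mul_one,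
      ← Matrix.mulVec_mulVec, ← Matrix.mulVec_neg, ← Matrix.neg_mulVec, neg_sub]
  have hnorm : ‖fiberPart (δ * g)‖ ≤ M * r := by
    rw [hfib, norm_neg]
    refine (Matrix.linfty_opNorm_mulVec _ _).trans ?_
    have := (hrot γ).2
    gcongr
  have hδD : ‖translationPart δ‖ ≤ D := by
    refine hD ⟨⟨δ, hδΓ⟩, ⟨QuotientGroup.mk (δ * g),
      ⟨QuotientGroup.mk g, hmem g ?_, rfl⟩, hmem _ hnorm⟩, rfl⟩
    rw [hg2, norm_zero]
    positivity
  have hconj : translationPart γ - translationPart γ' =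
      -(rotationPart γ * translationPart δ * (rotationPart γ)ᵀ) := by
    have : translationPart γ' = translationPart (γ * δ) := by rw [hδ, mul_inv_cancel_left]
    rw [this, translationPart_mul, sub_add_cancel_left]
  rw [hconj, norm_neg]
  have h1 := (hrot γ).1
  have h2 := (hrot γ).2
  calc _ ≤ ‖rotationPart γ‖ * ‖translationPart δ‖ * ‖(rotationPart γ)ᵀ‖ :=
        (norm_mul_le _ _).trans (by gcongr; exact norm_mul_le _ _)
    _ ≤ M * D * M := by
      have hD0 : 0 ≤ D := (norm_nonneg _).trans hδD
      gcongr

/-- The lower half of `X v`, for `v` in the upper half space, as a bilinear map. -/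
def lowerMulVec (p q : ℕ) : (Fin p → ℝ) →ₗ[ℝ]
    Matrix (Fin p ⊕ Fin q) (Fin p ⊕ Fin q) ℝ →ₗ[ℝ] (Fin q → ℝ) :=
  LinearMap.mk₂ ℝ (fun v X => (X *ᵥ Sum.elim v 0) ∘ Sum.inr)
    (fun v v' X => by
      have : (Sum.elim (v + v') 0 : Fin p ⊕ Fin q → ℝ) = Sum.elim v 0 + Sum.elim v' 0 := by
        ext (i | i) <;> simp
      rw [this, Matrix.mulVec_add]; rfl)
    (fun c v X => by
      have : (Sum.elim (c • v) 0 : Fin p ⊕ Fin q → ℝ) = c • Sum.elim v 0 := by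
        ext (i | i) <;> simp
      rw [this, Matrix.mulVec_smul]; rfl)
    (fun v X X' => by rw [Matrix.add_mulVec]; rfl)
    (fun c v X => by rw [Matrix.smul_mulVec]; rfl)

theorem norm_comp_inr_le (x : Fin p ⊕ Fin q → ℝ) : ‖x ∘ Sum.inr‖ ≤ ‖x‖ :=
  (pi_norm_le_iff_of_nonneg (norm_nonneg _)).2 fun i => norm_le_pi_norm x (Sum.inr i)

/-- Applies the linearisation to the translation parts of `Γ` and to evaluation at unit vectors; the
base section, at `e₀`, could be taken at any unit vector. -/
theorem exists_bilinear_of_compactCliffordKleinForm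
    (h : AdmitsCompactCliffordKleinForm (tangentialSubgroup (indefiniteOrthogonal (p + 1) q)
      (indefiniteOrthogonalStabilizer p q))) :
    ∃ f : (Fin (p + 1) → ℝ) →ₗ[ℝ] (Fin q → ℝ) →ₗ[ℝ] (Fin q → ℝ),
      ∀ v w, f v w = 0 → v = 0 ∨ w = 0 := by
  obtain ⟨Γ, hΓ, hc⟩ := h
  obtain ⟨M, hM, hrot⟩ := norm_rotationPart_le p q
  obtain ⟨R, hR⟩ := exists_norm_fiberPart_mul_le hc
  let S : Set (Matrix (Fin (p + 1) ⊕ Fin q) (Fin (p + 1) ⊕ Fin q) ℝ →L[ℝ] (Fin q → ℝ)) :=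
    {s | ∃ v : Fin (p + 1) → ℝ, v ⬝ᵥ v = 1 ∧
      s = LinearMap.toContinuousLinearMap (lowerMulVec (p + 1) q v)}
  have hsign : ∀ v : Fin (p + 1) → ℝ, signature (p + 1) q *ᵥ (Sum.elim v 0) = Sum.elim v 0 := by
    intro v; rw [signature_mulVec]; simp
  have hdot : ∀ v : Fin (p + 1) → ℝ,
      (Sum.elim v 0 : Fin (p + 1) ⊕ Fin q → ℝ) ⬝ᵥ Sum.elim v 0 = v ⬝ᵥ v := by
    intro v; simp [dotProduct]
  have hmain := exists_linear_section (T := translationPart '' (Γ : Set (MotionGroup p q)))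
    (S := S) (R := M * R) (s₀ := LinearMap.toContinuousLinearMap
      (lowerMulVec (p + 1) q (Pi.single 0 1))) ?_ ?_ ⟨_, by simp, rfl⟩
  · obtain ⟨L, -, hL⟩ := hmain
    refine ⟨(lowerMulVec (p + 1) q).compl₂ L.toLinearMap, fun v w hvw => ?_⟩
    by_cases hv : v = 0
    · exact Or.inl hv
    right
    have hpos : 0 < v ⬝ᵥ v :=
      lt_of_le_of_ne (by simpa using dotProduct_star_self_nonneg v)
        fun h => hv (dotProduct_self_eq_zero.1 h.symm)
    -- Nonsingularity is known at unit vectors and spreads to all nonzero `v` by scaling.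
    refine hL _ ⟨(√(v ⬝ᵥ v))⁻¹ • v, ?_, rfl⟩ w ?_
    · rw [smul_dotProduct, dotProduct_smul, smul_eq_mul, smul_eq_mul, ← mul_assoc, ← mul_inv,
        Real.mul_self_sqrt hpos.le, inv_mul_cancel₀ hpos.ne']
    · change lowerMulVec (p + 1) q v (L w) = 0 at hvw
      change lowerMulVec (p + 1) q ((√(v ⬝ᵥ v))⁻¹ • v) (L w) = 0
      rw [map_smul, LinearMap.smul_apply, hvw, smul_zero]
  · rintro s ⟨v, hv, rfl⟩ w
    have hw : signature (p + 1) q *ᵥ (Sum.elim (0 : Fin (p + 1) → ℝ) w) =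
        -(Sum.elim (0 : Fin (p + 1) → ℝ) w) := by
      rw [signature_mulVec]; ext (i | i) <;> simp
    obtain ⟨g, hg1, hg2⟩ := exists_spherePart_fiberPart_eq (hsign v) hw (by rw [hdot, hv])
    obtain ⟨γ, hγ, hγR⟩ := hR g
    -- If `γ` brings `(v, w)` close to the zero section, then the translation part of `γ⁻¹` sends
    -- `v` close to `w`.
    refine ⟨_, ⟨γ⁻¹, Γ.inv_mem hγ, rfl⟩, ?_⟩
    have e : translationPart γ⁻¹ *ᵥ Sum.elim v 0 - Sum.elim (0 : Fin (p + 1) → ℝ) w =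
        -((rotationPart γ)ᵀ *ᵥ fiberPart (γ * g)) := by
      have h1 : translationPart γ⁻¹ =
          (rotationPart γ)ᵀ * (-translationPart γ) * rotationPart γ := by
        have := translationPart_inv_mul γ 1
        rwa [mul_one, translationPart_one, zero_sub] at this
      rw [fiberPart_mul, hg1, hg2, Matrix.mulVec_add, Matrix.mulVec_mulVec,
        transpose_rotationPart_mul_self, Matrix.one_mulVec, h1, mul_neg, neg_mul,
        Matrix.neg_mulVec, Matrix.mulVec_mulVec, Matrix.mulVec_mulVec]
      abel
    change ‖(translationPart γ⁻¹ *ᵥ Sum.elim v 0 - Sum.elim (0 : Fin (p + 1) → ℝ) w) ∘ Sum.inr‖ ≤ _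
    rw [e]
    refine (norm_comp_inr_le _).trans ?_
    rw [norm_neg]
    refine (Matrix.linfty_opNorm_mulVec _ _).trans ?_
    have := (hrot γ).2
    gcongr
  · intro r
    obtain ⟨D, hD⟩ := exists_norm_translationPart_sub_le hΓ.properlyDiscontinuous r
    refine ⟨D, ?_⟩
    rintro s ⟨v, hv, rfl⟩ _ ⟨γ, hγ, rfl⟩ _ ⟨γ', hγ', rfl⟩ hs
    refine hD _ (hsign v) (by rw [hdot, hv]) γ hγ γ' hγ' ?_
    have hmem : translationPart γ - translationPart γ' ∈
        symmetricPart (indefiniteOrthogonal (p + 1) q) :=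
      sub_mem γ.left.toAdd.2 γ'.left.toAdd.2
    -- Elements of `𝔭` map upper vectors to lower ones, so `lowerMulVec` loses nothing.
    rw [eq_elim_of_signature_mulVec_eq_neg (signature_mulVec_symmetricPart hmem (hsign v)),
      norm_elim_zero_left]
    exact hs

/-! ## From a bilinear map to a compact Clifford–Klein form -/

/-- A nondegenerate bilinear map is bounded from below on pairs. -/
theorem exists_pos_mul_norm_le_norm_bilinear {E F F' : Type*}
    [NormedAddCommGroup E] [NormedSpace ℝ E] [FiniteDimensional ℝ E]
    [NormedAddCommGroup F] [NormedSpace ℝ F] [FiniteDimensional ℝ F]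
    [NormedAddCommGroup F'] [NormedSpace ℝ F'] (f : E →L[ℝ] F →L[ℝ] F')
    (hf : ∀ v w, f v w = 0 → v = 0 ∨ w = 0) :
    ∃ c : ℝ, 0 < c ∧ ∀ v w, c * (‖v‖ * ‖w‖) ≤ ‖f v w‖ := by
  have hcpt := (isCompact_sphere (0 : E) 1).prod (isCompact_sphere (0 : F) 1)
  have hcont : Continuous fun x : E × F => ‖f x.1 x.2‖ := f.continuous₂.norm
  -- The minimum on the product of the unit spheres is positive; this form also covers empty
  -- spheres, as for `q = 0`.
  obtain ⟨c, hc, h⟩ := hcpt.exists_forall_le' hcont.continuousOn (a := 0) fun x hx => by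
    rw [norm_pos_iff]
    intro h0
    rcases hf _ _ h0 with h1 | h1
    · simpa [h1] using hx.1
    · simpa [h1] using hx.2
  refine ⟨c, hc, fun v w => ?_⟩
  by_cases hv : v = 0
  · simp [hv]
  by_cases hw : w = 0
  · simp [hw]
  have hv' := norm_pos_iff.2 hv
  have hw' := norm_pos_iff.2 hw
  have := h (‖v‖⁻¹ • v, ‖w‖⁻¹ • w) ⟨by simp [norm_smul, hv'.ne'], by simp [norm_smul, hw'.ne']⟩
  dsimp only at this
  rw [map_smul, map_smul, _root_.smul_apply, norm_smul, norm_smul, norm_inv, norm_inv,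
    norm_norm, norm_norm, ← mul_assoc, ← mul_inv, ← div_eq_inv_mul,
    le_div_iff₀ (by positivity)] at this
  rwa [mul_comm ‖v‖]

/-- The homomorphism of a lattice in a vector space into the Cartan motion group which is given by
a linear map of the vector space to `𝔭`. -/
def latticeHom {n : Type*} [Fintype n] [DecidableEq n] {G : Subgroup (GL n ℝ)} {ι : Type*}
    (L : (ι → ℝ) →ₗ[ℝ] symmetricPart G) : Multiplicative (ι → ℤ) →* CartanMotionGroup G :=
  (SemidirectProduct.inl : _ →* Multiplicative (symmetricPart G) ⋊[adjointAction G] _).comp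
    (AddMonoidHom.toMultiplicative
      (L.toAddMonoidHom.comp ((Int.castAddHom ℝ).compLeft ι)))

theorem rotationPart_latticeHom
    (L : (Fin q → ℝ) →ₗ[ℝ] symmetricPart (indefiniteOrthogonal (p + 1) q))
    (z : Multiplicative (Fin q → ℤ)) : rotationPart (latticeHom L z) = 1 := rfl

theorem translationPart_latticeHom
    (L : (Fin q → ℝ) →ₗ[ℝ] symmetricPart (indefiniteOrthogonal (p + 1) q))
    (z : Multiplicative (Fin q → ℤ)) :
    translationPart (latticeHom L z) = L (fun i => (z.toAdd i : ℝ)) := rfl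

theorem fiberPart_latticeHom_mul
    (L : (Fin q → ℝ) →ₗ[ℝ] symmetricPart (indefiniteOrthogonal (p + 1) q))
    (z : Multiplicative (Fin q → ℤ)) (g : MotionGroup p q) :
    fiberPart (latticeHom L z * g) =
      fiberPart g + (L (fun i => (z.toAdd i : ℝ))).1 *ᵥ spherePart g := by
  rw [fiberPart_mul, rotationPart_latticeHom, translationPart_latticeHom, Matrix.one_mulVec,
    Matrix.one_mulVec]

theorem fiberPoint_latticeHom_smul
    (L : (Fin q → ℝ) →ₗ[ℝ] symmetricPart (indefiniteOrthogonal (p + 1) q))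
    (z : Multiplicative (Fin q → ℤ)) (x : TangentialSpace p q) :
    fiberPoint (latticeHom L z • x) =
      fiberPoint x + (L (fun i => (z.toAdd i : ℝ))).1 *ᵥ spherePoint x := by
  rw [fiberPoint_smul, rotationPart_latticeHom, translationPart_latticeHom, Matrix.one_mulVec,
    Matrix.one_mulVec]

theorem finite_setOf_norm_intCast_le (r : ℝ) :
    {z : Multiplicative (Fin q → ℤ) | ‖fun i => (z.toAdd i : ℝ)‖ ≤ r}.Finite := by
  have hfin : (Set.Icc (fun _ => -⌈r⌉) (fun _ => ⌈r⌉) : Set (Fin q → ℤ)).Finite :=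
    Set.finite_Icc _ _
  refine (hfin.preimage (f := Multiplicative.toAdd) Multiplicative.toAdd.injective.injOn).subset
    fun z hz => ?_
  have hz' : ‖fun i => (z.toAdd i : ℝ)‖ ≤ r := hz
  have h : ∀ i, |(z.toAdd i : ℝ)| ≤ ⌈r⌉ := fun i =>
    ((norm_le_pi_norm (fun i => (z.toAdd i : ℝ)) i).trans hz').trans (Int.le_ceil r)
  refine ⟨fun i => ?_, fun i => ?_⟩
  · have := (abs_le.1 (h i)).1
    exact_mod_cast this
  · have := (abs_le.1 (h i)).2
    exact_mod_cast this

/-- A linear family of translations which is uniformly expanding in every fibre, and translates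
every point by lattice vectors into a bounded part, contains the required discontinuous group. -/
theorem admitsCompactCliffordKleinForm_of_expanding
    (L : (Fin q → ℝ) →ₗ[ℝ] symmetricPart (indefiniteOrthogonal (p + 1) q)) {c R : ℝ} (hc : 0 < c)
    (hexp : ∀ (x : TangentialSpace p q) y, c * ‖y‖ ≤ ‖(L y).1 *ᵥ spherePoint x‖)
    (hcov : ∀ g : MotionGroup p q, ∃ z, ‖fiberPart (latticeHom L z * g)‖ ≤ R) :
    AdmitsCompactCliffordKleinForm (tangentialSubgroup (indefiniteOrthogonal (p + 1) q)
      (indefiniteOrthogonalStabilizer p q)) := by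
  refine ⟨(latticeHom L).range, ⟨?_, ⟨?_⟩, ?_⟩, ?_⟩
  · rw [discreteTopology_iff_isOpen_singleton]
    rintro ⟨_, z, rfl⟩
    have hcont : Continuous fun γ : (latticeHom L).range => fiberPart γ.1 :=
      continuous_fiberPart.comp continuous_subtype_val
    -- Distinct integer vectors are at sup distance at least 1, so expansion keeps their fibre
    -- coordinates over `e₀` at least `c` apart.
    have hopen := isOpen_lt (hcont.sub (continuous_const (y := fiberPart (latticeHom L z)))).norm
      (continuous_const (y := c))
    convert! hopen using 1
    ext ⟨_, z', rfl⟩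
    simp only [Set.mem_singleton_iff, Set.mem_ofPred_eq]
    constructor
    · intro h; simpa [h] using hc
    · intro h
      have h1 : fiberPart (latticeHom L z') - fiberPart (latticeHom L z) =
          (L (fun i => ((z'.toAdd - z.toAdd) i : ℤ))).1 *ᵥ
            spherePoint (QuotientGroup.mk 1 : TangentialSpace p q) := by
        have e1 := fiberPart_latticeHom_mul L z 1
        have e2 := fiberPart_latticeHom_mul L z' 1
        rw [mul_one] at e1 e2
        have e3 : (fun i => (((z'.toAdd - z.toAdd) i : ℤ) : ℝ)) =
            (fun i => (z'.toAdd i : ℝ)) - fun i => (z.toAdd i : ℝ) := by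
          ext i; simp
        rw [e1, e2, e3, map_sub, add_sub_add_left_eq_sub, Submodule.coe_sub, Matrix.sub_mulVec]
        rfl
      change ‖fiberPart (latticeHom L z') - fiberPart (latticeHom L z)‖ < c at h
      rw [h1] at h
      have h2 := (hexp _ _).trans_lt h
      have h3 : ‖fun i => (((z'.toAdd - z.toAdd) i : ℤ) : ℝ)‖ < 1 := by
        by_contra! h4
        nlinarith
      have h5 : z' = z := by
        refine Multiplicative.toAdd.injective (funext fun i => ?_)
        have h6 := (norm_le_pi_norm _ i).trans_lt h3
        rw [Real.norm_eq_abs, ← Int.cast_abs] at h6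
        have h7 : |(z'.toAdd - z.toAdd) i| < 1 := by exact_mod_cast h6
        exact sub_eq_zero.1 (Int.abs_lt_one_iff.1 h7)
      rw [h5]
  · intro A B hA hB
    obtain ⟨a, ha⟩ := hA.exists_bound_of_continuousOn continuous_fiberPoint.continuousOn
    obtain ⟨b, hb⟩ := hB.exists_bound_of_continuousOn continuous_fiberPoint.continuousOn
    -- A translation by `z` carrying a point of `A` into `B` changes the fibre coordinate by at most
    -- `a + b` and at least `c * ‖z‖`.
    refine ((finite_setOf_norm_intCast_le (q := q) ((a + b) / c)).image
      (latticeHom L).rangeRestrict).subset ?_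
    rintro ⟨_, z, rfl⟩ ⟨_, ⟨x, hx, rfl⟩, hy⟩
    refine ⟨z, ?_, rfl⟩
    change ‖fun i => (z.toAdd i : ℝ)‖ ≤ _
    rw [le_div_iff₀ hc, mul_comm]
    refine (hexp x _).trans ?_
    have h1 := hb _ hy
    change ‖fiberPoint (latticeHom L z • x)‖ ≤ b at h1
    have h2 : (L (fun i => (z.toAdd i : ℝ))).1 *ᵥ spherePoint x =
        fiberPoint (latticeHom L z • x) - fiberPoint x := by
      rw [fiberPoint_latticeHom_smul, add_sub_cancel_left]
    rw [h2]
    refine (norm_sub_le _ _).trans ?_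
    linarith [ha x hx]
  · rintro ⟨_, z, rfl⟩ x hx
    change latticeHom L z • x = x at hx
    have h1 := fiberPoint_latticeHom_smul L z x
    rw [hx, left_eq_add] at h1
    have h2 := hexp x fun i => (z.toAdd i : ℝ)
    rw [h1, norm_zero] at h2
    have h3 : ‖fun i => (z.toAdd i : ℝ)‖ ≤ 0 := by
      by_contra! h4
      nlinarith
    have h4 : z = 1 := by
      refine Multiplicative.toAdd.injective (funext fun i => ?_)
      exact Int.cast_eq_zero.1 (congrFun (norm_le_zero_iff.1 h3) i)
    exact Subtype.ext ((congrArg (latticeHom L) h4).trans (map_one _))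
  · obtain ⟨C, hC, hmem⟩ := exists_isCompact_of_norm_fiberPart_le p q R
    have hcont : Continuous (Quotient.mk (MulAction.orbitRel (latticeHom L).range
        (TangentialSpace p q))) := continuous_quot_mk
    refine isCompact_univ_iff.1 ?_
    convert! hC.image hcont using 1
    refine (Set.eq_univ_of_forall fun y => ?_).symm
    obtain ⟨x, rfl⟩ := Quotient.exists_rep y
    induction x using QuotientGroup.induction_on with
    | H g =>
      obtain ⟨z, hz⟩ := hcov g
      exact ⟨_, hmem _ hz, Quotient.sound (MulAction.orbitRel_apply.2 ⟨⟨_, z, rfl⟩, rfl⟩)⟩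

/-- The linear family of elements of `𝔭` which belongs to a bilinear map. -/
def symmetricOfBilinear (f : (Fin (p + 1) → ℝ) →ₗ[ℝ] (Fin q → ℝ) →ₗ[ℝ] (Fin q → ℝ)) :
    (Fin q → ℝ) →ₗ[ℝ] symmetricPart (indefiniteOrthogonal (p + 1) q) where
  toFun w := ⟨Matrix.fromBlocks 0 (LinearMap.toMatrix' (f.flip w))ᵀ
      (LinearMap.toMatrix' (f.flip w)) 0, by
    rw [mem_symmetricPart_iff, signature_eq_fromBlocks]
    constructor
    · simp [Matrix.fromBlocks_transpose]
    · simp [Matrix.fromBlocks_multiply, Matrix.fromBlocks_neg]⟩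
  map_add' w w' := by
    ext1
    simp [Matrix.fromBlocks_add]
  map_smul' c w := by
    ext1
    simp [Matrix.fromBlocks_smul]

theorem symmetricOfBilinear_mulVec (f : (Fin (p + 1) → ℝ) →ₗ[ℝ] (Fin q → ℝ) →ₗ[ℝ] (Fin q → ℝ))
    (w : Fin q → ℝ) (v : Fin (p + 1) → ℝ) :
    (symmetricOfBilinear f w).1 *ᵥ Sum.elim v 0 = Sum.elim (0 : Fin (p + 1) → ℝ) (f v w) := by
  change Matrix.fromBlocks _ _ _ _ *ᵥ _ = _
  rw [Matrix.fromBlocks_mulVec]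
  simp [LinearMap.toMatrix'_mulVec]

theorem admitsCompactCliffordKleinForm_of_bilinear
    (f : (Fin (p + 1) → ℝ) →ₗ[ℝ] (Fin q → ℝ) →ₗ[ℝ] (Fin q → ℝ))
    (hf : ∀ v w, f v w = 0 → v = 0 ∨ w = 0) :
    AdmitsCompactCliffordKleinForm (tangentialSubgroup (indefiniteOrthogonal (p + 1) q)
      (indefiniteOrthogonalStabilizer p q)) := by
  obtain ⟨M, hM, hrot⟩ := norm_rotationPart_le p q
  have hM0 : 0 < M := by linarith
  let F : (Fin (p + 1) → ℝ) →L[ℝ] (Fin q → ℝ) →L[ℝ] (Fin q → ℝ) :=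
    LinearMap.toContinuousLinearMap
      ((LinearMap.toContinuousLinearMap : ((Fin q → ℝ) →ₗ[ℝ] (Fin q → ℝ)) ≃ₗ[ℝ] _).toLinearMap ∘ₗ f)
  have hF : ∀ v w, F v w = f v w := fun _ _ => rfl
  obtain ⟨c, hc, hcf⟩ := exists_pos_mul_norm_le_norm_bilinear F hf
  have hsph : ∀ g : MotionGroup p q, spherePart g = Sum.elim (spherePart g ∘ Sum.inl) 0 :=
    fun g => eq_elim_of_signature_mulVec_eq (signature_mulVec_spherePart g)
  have hnorm : ∀ g : MotionGroup p q, ‖spherePart g ∘ Sum.inl‖ = ‖spherePart g‖ := fun g => by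
    conv_rhs => rw [hsph g, norm_elim_zero_right]
  have hupper : ∀ g : MotionGroup p q, ‖spherePart g‖ ≤ M := fun g => by
    refine (Matrix.linfty_opNorm_mulVec _ _).trans ?_
    rw [norm_baseVector, mul_one]
    exact (hrot g).1
  -- Sphere points have Euclidean length 1, but in the sup norm they are only known to lie between
  -- `M⁻¹` and `M`.
  have hlower : ∀ g : MotionGroup p q, M⁻¹ ≤ ‖spherePart g‖ := fun g => by
    have h1 : (rotationPart g)ᵀ *ᵥ spherePart g = baseVector p q := by
      rw [spherePart, Matrix.mulVec_mulVec, transpose_rotationPart_mul_self, Matrix.one_mulVec]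
    have h2 := Matrix.linfty_opNorm_mulVec (rotationPart g)ᵀ (spherePart g)
    rw [h1, norm_baseVector] at h2
    rw [inv_le_iff_one_le_mul₀' hM0]
    refine h2.trans ?_
    have := (hrot g).2
    gcongr
  refine admitsCompactCliffordKleinForm_of_expanding (symmetricOfBilinear f)
    (c := c * M⁻¹) (R := ‖F‖ * M * 1) (by positivity) (fun x y => ?_) fun g => ?_
  · induction x using QuotientGroup.induction_on with
    | H g =>
      change _ ≤ ‖_ *ᵥ spherePart g‖
      rw [hsph g, symmetricOfBilinear_mulVec, norm_elim_zero_left]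
      refine le_trans ?_ (hcf (spherePart g ∘ Sum.inl) y)
      rw [hnorm, mul_assoc]
      have := hlower g
      gcongr
  · have hinj : Function.Injective (f (spherePart g ∘ Sum.inl)) := by
      rw [injective_iff_map_eq_zero]
      intro w hw
      refine (hf _ _ hw).resolve_left fun h0 => ?_
      have := hlower g
      rw [← hnorm, h0, norm_zero] at this
      exact absurd this (not_le.2 (by positivity))
    -- Here it matters that source and target both have dimension `q`. Subtracting the integer parts
    -- of `y` leaves fractional parts of norm at most 1, hence the bound `‖F‖ * M * 1`.
    obtain ⟨y, hy⟩ := LinearMap.injective_iff_surjective.1 hinj (fiberPart g ∘ Sum.inr)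
    have hfib := eq_elim_of_signature_mulVec_eq_neg (signature_mulVec_fiberPart g)
    refine ⟨Multiplicative.ofAdd fun i => -⌊y i⌋, ?_⟩
    have e : fiberPart (latticeHom (symmetricOfBilinear f)
        (Multiplicative.ofAdd fun i => -⌊y i⌋) * g) =
        Sum.elim (0 : Fin (p + 1) → ℝ) (F (spherePart g ∘ Sum.inl) fun i => Int.fract (y i)) := by
      rw [fiberPart_latticeHom_mul, hsph g, symmetricOfBilinear_mulVec, hfib, ← hy]
      have e1 : (fun i => Int.fract (y i)) = y + fun i => ((-⌊y i⌋ : ℤ) : ℝ) := by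
        ext i
        simp [Int.fract, sub_eq_add_neg]
      rw [e1, map_add, hF, hF]
      ext (i | i) <;> simp
    rw [e, norm_elim_zero_left]
    refine (F.le_opNorm₂ _ _).trans ?_
    rw [hnorm]
    have h1 := hupper g
    have h2 : ‖fun i => Int.fract (y i)‖ ≤ 1 :=
      (pi_norm_le_iff_of_nonneg zero_le_one).2 fun i => by
        rw [Real.norm_of_nonneg (Int.fract_nonneg _)]
        exact (Int.fract_lt_one _).le
    gcongr

end TangentialSpaceForm

end

theorem mainTheorem7 (p q : ℕ) :
    TangentialSpaceForm.AdmitsCompactCliffordKleinForm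
        (TangentialSpaceForm.tangentialSubgroup
          (TangentialSpaceForm.indefiniteOrthogonal (p + 1) q)
          (TangentialSpaceForm.indefiniteOrthogonalStabilizer p q)) ↔
      ∃ f : (Fin (p + 1) → ℝ) →ₗ[ℝ] (Fin q → ℝ) →ₗ[ℝ] (Fin q → ℝ),
        ∀ v w, f v w = 0 → v = 0 ∨ w = 0 := by
  exact ⟨TangentialSpaceForm.exists_bilinear_of_compactCliffordKleinForm, fun ⟨f, hf⟩ =>
    TangentialSpaceForm.admitsCompactCliffordKleinForm_of_bilinear f hf⟩
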